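/- Let $3\le d_A\le d_B\le d_C$ and $0\le n\le\lfloor (d_A-3)/2\rfloor$. Let $\{|0\rangle,\dots,|d_X-1\rangle\}$ be the computational basis of $\mathbb C^{d_X}$, $X\in\{A,B,C\}$, put $w_m=e^{2\pi\sqrt{-1}/m}$, $\mathbb Z_m=\{0,\dots,m-1\}$, and, for $0\le t\le n$, $X_t=d_X-2t$ (so $A_t=d_A-2t$, $B_t=d_B-2t$, $C_t=d_C-2t$) and $$|\eta^{(t)}_s\rangle_X=\sum_{u=0}^{X_t-2}w_{X_t-1}^{su}|t+u\rangle_X,\qquad |\xi^{(t)}_s\rangle_X=\sum_{u=0}^{X_t-2}w_{X_t-1}^{su}|t+u+1\rangle_X\qquad(s\in\mathbb Z_{X_t-1}),$$ $$|\beta^{(t)}_s\rangle_X=\sum_{u=0}^{X_t-3}w_{X_t-2}^{su}|t+u+1\rangle_X\qquad(s\in\mathbb Z_{X_t-2}).$$ In $\mathbb C^{d_A}\otimes\mathbb C^{d_B}\otimes\mathbb C^{d_C}$ define \begin{align*} \mathcal A_1^{(t)}&=\{|\xi_i^{(t)}\rangle_A|t\rangle_B|\eta_k^{(t)}\rangle_C:(i,k)\in\mathbb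 Z_{A_t-1}\times\mathbb Z_{C_t-1}\setminus\{(0,0)\}\},\\ \mathcal A_2^{(t)}&=\{|\xi_i^{(t)}\rangle_A|\eta_j^{(t)}\rangle_B|d_C-1-t\rangle_C:(i,j)\in\mathbb Z_{A_t-1}\times\mathbb Z_{B_t-1}\setminus\{(0,0)\}\},\\ \mathcal A_3^{(t)}&=\{|d_A-1-t\rangle_A|\xi_j^{(t)}\rangle_B|\eta_k^{(t)}\rangle_C:(j,k)\in\mathbb Z_{B_t-1}\times\mathbb Z_{C_t-1}\setminus\{(0,0)\}\},\\ \mathcal B_1^{(t)}&=\{|\eta_i^{(t)}\rangle_A|d_B-1-t\rangle_B|\xi_k^{(t)}\rangle_C:(i,k)\in\mathbb Z_{A_t-1}\times\mathbb Z_{C_t-1}\setminus\{(0,0)\}\},\\ \mathcal B_2^{(t)}&=\{|\eta_i^{(t)}\rangle_A|\xi_j^{(t)}\rangle_B|t\rangle_C:(i,j)\in\mathbb Z_{A_t-1}\times\mathbb Z_{B_t-1}\setminus\{(0,0)\}\},\\ \mathcal B_3^{(t)}&=\{|t\rangle_A|\eta_j^{(t)}\rangle_B|\xi_k^{(t)}\rangle_C:(j,k)\in\mathbb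 Z_{B_t-1}\times\mathbb Z_{C_t-1}\setminus\{(0,0)\}\},\\ \mathcal F^{(n)}&=\{|\beta_i^{(n)}\rangle_A|\beta_j^{(n)}\rangle_B|\beta_k^{(n)}\rangle_C:(i,j,k)\in\mathbb Z_{A_n-2}\times\mathbb Z_{B_n-2}\times\mathbb Z_{C_n-2}\setminus\{(0,0,0)\}\},\\ |S\rangle&=\Big(\sum_{i=0}^{d_A-1}|i\rangle\Big)_A\Big(\sum_{j=0}^{d_B-1}|j\rangle\Big)_B\Big(\sum_{k=0}^{d_C-1}|k\rangle\Big)_C, \end{align*} and $\mathcal U_n=\bigcup_{t=0}^n\bigcup_{i=1}^3\big(\mathcal A_i^{(t)}\cup\mathcal B_i^{(t)}\big)\cup\mathcal F^{(n)}\cup\{|S\rangle\}$. Then $\mathcal U_n$ is an unextendible product basis, that is, a set of nonzero, mutually orthogonal (unnormalized) product vectors which does not span the whole space and whose orthogonal complement contains no nonzero product vector. It has exactly $d_Ad_Bd_C-8(n+1)$ elements. It is moreover strongly nonlocal, that is, locally irreducible in each of the bipartitions $A|BC$, $B|CA$, $C|AB$: no state of $\mathcal U_n$ can be eliminated by orthogonality-preserving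 local measurements. Here a local measurement is a finite family of operators $M_k$ on one of the two sides with $\sum_kM_k^\dagger M_k=\mathbb I$; the two sides may perform finitely many of them one after the other, choosing each according to the earlier outcomes; each must leave the postmeasurement states mutually orthogonal for every outcome; and a state is eliminated if some sequence of outcomes annihilates it but does not annihilate all states of the set. -/

import Mathlib

open scoped Kronecker

noncomputable section

/-! ### Bipartite systems: local measurements and local irreducibility -/

/-- The action of a matrix on a state vector of a bipartite system `ℂ^X ⊗ ℂ^Y`, identified with
`EuclideanSpace ℂ (X × Y)` by its computational basis. -/
def actOn {X Y : Type} [Fintype X] [Fintype Y] [DecidableEq X] [DecidableEq Y]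
    (K : Matrix (X × Y) (X × Y) ℂ) (ψ : EuclideanSpace ℂ (X × Y)) : EuclideanSpace ℂ (X × Y) :=
  Matrix.toEuclideanLin K ψ

/-- `L` is a family of measurement operators `M k` of one party (POVM elements `(M k)ᴴ * M k`,
which sum to the identity), extended by the identity on the other party. -/
def IsLocalMeasurement {X Y : Type} [Fintype X] [Fintype Y] [DecidableEq X] [DecidableEq Y]
    {r : ℕ} (L : Fin r → Matrix (X × Y) (X × Y) ℂ) : Prop :=
  (∃ M : Fin r → Matrix X X ℂ, ∑ k, (M k).conjTranspose * M k = 1 ∧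
      ∀ k, L k = M k ⊗ₖ (1 : Matrix Y Y ℂ)) ∨
  (∃ M : Fin r → Matrix Y Y ℂ, ∑ k, (M k).conjTranspose * M k = 1 ∧
      ∀ k, L k = (1 : Matrix X X ℂ) ⊗ₖ M k)

/-- The images under `K` of distinct states of `U` are orthogonal. -/
def KeepsOrthogonal {X Y : Type} [Fintype X] [Fintype Y] [DecidableEq X] [DecidableEq Y]
    (U : Set (EuclideanSpace ℂ (X × Y))) (K : Matrix (X × Y) (X × Y) ℂ) : Prop :=
  U.Pairwise fun ψ φ => inner ℂ (actOn K ψ) (actOn K φ) = 0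

/-- `Reachable U K`: the operator `K` is the accumulated effect of one branch of a finite
adaptive sequence of local measurements by the two parties, each of which keeps the
postmeasurement states of `U` mutually orthogonal for every one of its outcomes. -/
inductive Reachable {X Y : Type} [Fintype X] [Fintype Y] [DecidableEq X] [DecidableEq Y]
    (U : Set (EuclideanSpace ℂ (X × Y))) : Matrix (X × Y) (X × Y) ℂ → Prop
  | start : Reachable U 1
  | measure {K : Matrix (X × Y) (X × Y) ℂ} (hK : Reachable U K) {r : ℕ}
      (L : Fin r → Matrix (X × Y) (X × Y) ℂ) (hL : IsLocalMeasurement L)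
      (hU : ∀ k, KeepsOrthogonal U (L k * K)) (k : Fin r) : Reachable U (L k * K)

/-- No state of `U` can be eliminated by orthogonality-preserving local measurements: along every
branch that can occur for some state of `U`, every state of `U` survives. -/
def LocallyIrreducible {X Y : Type} [Fintype X] [Fintype Y] [DecidableEq X] [DecidableEq Y]
    (U : Set (EuclideanSpace ℂ (X × Y))) : Prop :=
  ∀ K, Reachable U K → (∃ φ ∈ U, actOn K φ ≠ 0) → ∀ ψ ∈ U, actOn K ψ ≠ 0

/-! ### Tripartite systems -/

/-- The system `ℂ^a ⊗ ℂ^b ⊗ ℂ^c`, in coordinates with respect to the computational basis. -/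
abbrev Tri (a b c : ℕ) : Type := EuclideanSpace ℂ (Fin a × Fin b × Fin c)

/-- The vector `x ⊗ y ⊗ z`. -/
def triProd {a b c : ℕ} (x : EuclideanSpace ℂ (Fin a)) (y : EuclideanSpace ℂ (Fin b))
    (z : EuclideanSpace ℂ (Fin c)) : Tri a b c :=
  WithLp.toLp 2 fun p => x p.1 * y p.2.1 * z p.2.2

/-- States are nonzero vectors, not necessarily normalized. -/
def IsProductState {a b c : ℕ} (ψ : Tri a b c) : Prop :=
  ψ ≠ 0 ∧ ∃ x y z, ψ = triProd x y z

/-- Orthogonal product set. -/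
def IsOPS {a b c : ℕ} (U : Set (Tri a b c)) : Prop :=
  (∀ ψ ∈ U, IsProductState ψ) ∧ U.Pairwise fun ψ φ => inner ℂ ψ φ = 0

/-- Unextendible product basis: an incomplete orthogonal product set whose complementary subspace
contains no product state. -/
def IsUPB {a b c : ℕ} (U : Set (Tri a b c)) : Prop :=
  IsOPS U ∧ Submodule.span ℂ U ≠ ⊤ ∧ ∀ ψ ∈ (Submodule.span ℂ U)ᗮ, ¬ IsProductState ψ

/-- Regrouping `(i, j, k) ↦ (j, (k, i))` for the bipartition `B|CA`. -/
def groupB (a b c : ℕ) : Fin a × Fin b × Fin c ≃ Fin b × (Fin c × Fin a) where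
  toFun p := (p.2.1, (p.2.2, p.1))
  invFun q := (q.2.2, q.1, q.2.1)
  left_inv _ := rfl
  right_inv _ := rfl

/-- Regrouping `(i, j, k) ↦ (k, (i, j))` for the bipartition `C|AB`. -/
def groupC (a b c : ℕ) : Fin a × Fin b × Fin c ≃ Fin c × (Fin a × Fin b) where
  toFun p := (p.2.2, (p.1, p.2.1))
  invFun q := (q.2.1, q.2.2, q.1)
  left_inv _ := rfl
  right_inv _ := rfl

/-- Strong nonlocality of an orthogonal product set: local irreducibility in each of the
bipartitions `A|BC`, `B|CA` and `C|AB`. -/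
def StronglyNonlocal {a b c : ℕ} (U : Set (Tri a b c)) : Prop :=
  IsOPS U ∧
  LocallyIrreducible U ∧
  LocallyIrreducible (LinearIsometryEquiv.piLpCongrLeft 2 ℂ ℂ (groupB a b c) '' U) ∧
  LocallyIrreducible (LinearIsometryEquiv.piLpCongrLeft 2 ℂ ℂ (groupC a b c) '' U)

/-! ### The construction -/

/-- The primitive root of unity `exp (2πi / m)`. -/
def w (m : ℕ) : ℂ := Complex.exp (2 * Real.pi * Complex.I / m)

/-- The computational basis vector `|t⟩` of `ℂ^d`, for `t < d`. -/
def ket (d t : ℕ) : EuclideanSpace ℂ (Fin d) :=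
  WithLp.toLp 2 fun x => if (x : ℕ) = t then 1 else 0

/-- `|η_s^{(n)}⟩ = ∑_{u=0}^{d-2n-2} w_{d-2n-1}^{su} |n+u⟩`. -/
def eta (d n s : ℕ) : EuclideanSpace ℂ (Fin d) :=
  ∑ u ∈ Finset.range (d - 2 * n - 1), w (d - 2 * n - 1) ^ (s * u) • ket d (n + u)

/-- `|ξ_s^{(n)}⟩ = ∑_{u=0}^{d-2n-2} w_{d-2n-1}^{su} |n+u+1⟩`. -/
def xi (d n s : ℕ) : EuclideanSpace ℂ (Fin d) :=
  ∑ u ∈ Finset.range (d - 2 * n - 1), w (d - 2 * n - 1) ^ (s * u) • ket d (n + u + 1)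

/-- `|β_s^{(n)}⟩ = ∑_{u=0}^{d-2n-3} w_{d-2n-2}^{su} |n+u+1⟩`. -/
def beta (d n s : ℕ) : EuclideanSpace ℂ (Fin d) :=
  ∑ u ∈ Finset.range (d - 2 * n - 2), w (d - 2 * n - 2) ^ (s * u) • ket d (n + u + 1)

/-- The index set `ℤ_p × ℤ_q ∖ {(0,0)}`. -/
def idx (p q : ℕ) : Set (ℕ × ℕ) := {v | v.1 < p ∧ v.2 < q ∧ v ≠ (0, 0)}

def setA1 (a b c n : ℕ) : Set (Tri a b c) :=
  (fun v : ℕ × ℕ => triProd (xi a n v.1) (ket b n) (eta c n v.2)) ''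
    idx (a - 2 * n - 1) (c - 2 * n - 1)

def setA2 (a b c n : ℕ) : Set (Tri a b c) :=
  (fun v : ℕ × ℕ => triProd (xi a n v.1) (eta b n v.2) (ket c (c - 1 - n))) ''
    idx (a - 2 * n - 1) (b - 2 * n - 1)

def setA3 (a b c n : ℕ) : Set (Tri a b c) :=
  (fun v : ℕ × ℕ => triProd (ket a (a - 1 - n)) (xi b n v.1) (eta c n v.2)) ''
    idx (b - 2 * n - 1) (c - 2 * n - 1)

def setB1 (a b c n : ℕ) : Set (Tri a b c) :=
  (fun v : ℕ × ℕ => triProd (eta a n v.1) (ket b (b - 1 - n)) (xi c n v.2)) ''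
    idx (a - 2 * n - 1) (c - 2 * n - 1)

def setB2 (a b c n : ℕ) : Set (Tri a b c) :=
  (fun v : ℕ × ℕ => triProd (eta a n v.1) (xi b n v.2) (ket c n)) ''
    idx (a - 2 * n - 1) (b - 2 * n - 1)

def setB3 (a b c n : ℕ) : Set (Tri a b c) :=
  (fun v : ℕ × ℕ => triProd (ket a n) (eta b n v.1) (xi c n v.2)) ''
    idx (b - 2 * n - 1) (c - 2 * n - 1)

def setF (a b c n : ℕ) : Set (Tri a b c) :=
  (fun v : ℕ × ℕ × ℕ => triProd (beta a n v.1) (beta b n v.2.1) (beta c n v.2.2)) ''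
    {v | v.1 < a - 2 * n - 2 ∧ v.2.1 < b - 2 * n - 2 ∧ v.2.2 < c - 2 * n - 2 ∧ v ≠ (0, 0, 0)}

/-- The stopper state. -/
def stopper (a b c : ℕ) : Tri a b c :=
  triProd (∑ i ∈ Finset.range a, ket a i) (∑ j ∈ Finset.range b, ket b j)
    (∑ k ∈ Finset.range c, ket c k)

/-- The set `U_n`. -/
def setU (a b c n : ℕ) : Set (Tri a b c) :=
  (⋃ t ∈ Finset.range (n + 1),
    setA1 a b c t ∪ setA2 a b c t ∪ setA3 a b c t ∪
      (setB1 a b c t ∪ setB2 a b c t ∪ setB3 a b c t)) ∪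
  setF a b c n ∪ {stopper a b c}

end

/-!
The cube `[0, a) × [0, b) × [0, c)` is peeled into `n + 1` shells, each tiled by six boxes, and a
core. Apart from the stopper, the states are the nonconstant product Fourier vectors of the boxes.

A product vector orthogonal to all of them is constant on every box. If its first factor summed to
zero, the six boxes of a shell would force the factors to vanish at both ends of the shell, for one
shell after the other, leaving a nonzero constant on the core, a contradiction. So no factor sums
to zero, and the vector is not orthogonal to the stopper.

For nonlocality, let `1 ⊗ E`, with `E` Hermitian on the last two factors, preserve orthogonality.
Only the outermost shell matters. Its boxes, seen in the `b × c` plane, are the sides of two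
pinwheels and two rectangles that meet in the interior. Pairs of distinct boxes show that `E` has
no entries between different sides, or between a side and the rectangle of the other pinwheel;
a single box shows that `E` is diagonal on the nonconstant Fourier vectors of its rectangle. A
correction by the row and column of `E` at the corner missing from the rectangle extends this to
the constant vector, so the corrected matrix is translation invariant there, and translating
entries into known zeros makes `E` diagonal. The stopper makes the column sums of `E` constant,
hence `E` is scalar. Finally, every operator that a sequence of measurements can produce is then a
product of scaled isometries, which annihilates all states or none.
-/

open scoped Matrix

noncomputable section

/-- `(p, q)` and `(u, v)` have the same correlations `φ s p * star (φ s q)` in every member of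
the family `φ`. For Fourier vectors on a cyclic group this says `p - q = u - v`. -/
def SameCorrelation {T S : Type*} (I : Finset S) (φ : S → T → ℂ) (p q u v : T) : Prop :=
  ∀ s ∈ I, φ s p * star (φ s q) = φ s u * star (φ s v)

/-- An abstract Fourier basis of the functions supported on `D`: the `φ s` with `s ∈ I` are
orthogonal of squared norm `N`, `φ 0` is the indicator function of `D`, and pairs of points
of `D` can be translated without changing their correlations. -/
structure FourierOn {T S : Type*} [Fintype T] [DecidableEq T] [Zero S] [DecidableEq S]
    (D : Set T) (I : Finset S) (φ : S → T → ℂ) (N : ℕ) : Prop where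
  zero_mem : 0 ∈ I
  pos : N ≠ 0
  supp : ∀ s, ∀ p ∉ D, φ s p = 0
  zero_apply : ∀ p ∈ D, φ 0 p = 1
  orth : ∀ s ∈ I, ∀ s' ∈ I, star (φ s) ⬝ᵥ φ s' = if s = s' then (N : ℂ) else 0
  recon : ∀ p ∈ D, ∀ q ∈ D, ∑ s ∈ I, φ s p * star (φ s q) = if p = q then (N : ℂ) else 0
  exists_shift : ∀ p ∈ D, ∀ q ∈ D, ∀ p' ∈ D, ∃ q' ∈ D, SameCorrelation I φ p q p' q'

namespace FourierOn

variable {T S : Type*} [Fintype T] [DecidableEq T] [Zero S] [DecidableEq S]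
  {D : Set T} {I : Finset S} {φ : S → T → ℂ} {N : ℕ}

theorem natCast_ne_zero (h : FourierOn D I φ N) : (N : ℂ) ≠ 0 := Nat.cast_ne_zero.2 h.pos

theorem zero_dotProduct (h : FourierOn D I φ N) (g : T → ℂ) (hg : ∀ p ∉ D, g p = 0) :
    star (φ 0) ⬝ᵥ g = ∑ p, g p :=
  Finset.sum_congr rfl fun p _ => by
    by_cases hp : p ∈ D
    · simp [h.zero_apply p hp]
    · simp [hg p hp]

theorem sum_eq_zero (h : FourierOn D I φ N) {s : S} (hs : s ∈ I) (h0 : s ≠ 0) :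
    ∑ p, φ s p = 0 := by
  rw [← h.zero_dotProduct _ (h.supp s), h.orth 0 h.zero_mem s hs, if_neg h0.symm]

theorem sum_zero (h : FourierOn D I φ N) : ∑ p, φ 0 p = N := by
  rw [← h.zero_dotProduct _ (h.supp 0), h.orth 0 h.zero_mem 0 h.zero_mem, if_pos rfl]

theorem inversion (h : FourierOn D I φ N) (g : T → ℂ) {p : T} (hp : p ∈ D) :
    ∑ s ∈ I, φ s p * (star (φ s) ⬝ᵥ g) = N * g p := by
  have hcoeff : ∀ q, ∑ s ∈ I, φ s p * star (φ s q) * g q = if p = q then N * g q else 0 := by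
    intro q
    by_cases hq : q ∈ D
    · rw [← Finset.sum_mul, h.recon p hp q hq, ite_mul, zero_mul]
    · rw [if_neg (by rintro rfl; exact hq hp)]
      exact Finset.sum_eq_zero fun s _ => by simp [h.supp s q hq]
  simp only [dotProduct, Pi.star_apply, Finset.mul_sum, ← mul_assoc]
  rw [Finset.sum_comm, Finset.sum_congr rfl fun q _ => hcoeff q]
  simp

theorem eq_zero_of_coeff (h : FourierOn D I φ N) {g : T → ℂ}
    (hg : ∀ s ∈ I, star (φ s) ⬝ᵥ g = 0) {p : T} (hp : p ∈ D) : g p = 0 := by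
  have := h.inversion g hp
  rw [Finset.sum_eq_zero fun s hs => by rw [hg s hs, mul_zero]] at this
  exact (mul_eq_zero.1 this.symm).resolve_left h.natCast_ne_zero

theorem eq_of_coeff (h : FourierOn D I φ N) {g : T → ℂ}
    (hg : ∀ s ∈ I, s ≠ 0 → star (φ s) ⬝ᵥ g = 0) {p q : T} (hp : p ∈ D) (hq : q ∈ D) :
    g p = g q := by
  have key : ∀ r ∈ D, N * g r = star (φ 0) ⬝ᵥ g := fun r hr => by
    rw [← h.inversion g hr, Finset.sum_eq_single_of_mem 0 h.zero_mem
      fun s hs h0 => by rw [hg s hs h0, mul_zero], h.zero_apply r hr, one_mul]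
  exact mul_left_cancel₀ h.natCast_ne_zero ((key p hp).trans (key q hq).symm)

theorem dotProduct_eq_zero_of_const (h : FourierOn D I φ N) {g : T → ℂ} {s : S} (hs : s ∈ I)
    (h0 : s ≠ 0) (hg : ∀ p ∈ D, ∀ q ∈ D, g p = g q) : g ⬝ᵥ φ s = 0 := by
  rcases D.eq_empty_or_nonempty with rfl | ⟨r, hr⟩
  · exact Finset.sum_eq_zero fun p _ => by rw [h.supp s p (Set.notMem_empty p), mul_zero]
  have hconst : g ⬝ᵥ φ s = g r * ∑ p, φ s p := by
    rw [Finset.mul_sum]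
    refine Finset.sum_congr rfl fun p _ => ?_
    by_cases hp : p ∈ D
    · rw [hg p hp r hr]
    · rw [h.supp s p hp, mul_zero, mul_zero]
  rw [hconst, h.sum_eq_zero hs h0, mul_zero]

theorem matrix_inversion (h : FourierOn D I φ N) (E : Matrix T T ℂ) {p q : T} (hp : p ∈ D)
    (hq : q ∈ D) :
    ∑ s ∈ I, ∑ s' ∈ I, φ s p * star (φ s' q) * (star (φ s) ⬝ᵥ E *ᵥ φ s') = N * N * E p q := by
  have hrow : ∑ s' ∈ I, star (φ s' q) * (E *ᵥ φ s') p = N * E p q := by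
    have := congrArg star (h.inversion (star (E p)) hq)
    simpa [Matrix.mulVec, dotProduct, mul_comm] using this
  calc
    _ = ∑ s' ∈ I, star (φ s' q) * ∑ s ∈ I, φ s p * (star (φ s) ⬝ᵥ E *ᵥ φ s') := by
      rw [Finset.sum_comm]
      simp only [Finset.mul_sum]
      exact Finset.sum_congr rfl fun _ _ => Finset.sum_congr rfl fun _ _ => by ring
    _ = N * ∑ s' ∈ I, star (φ s' q) * (E *ᵥ φ s') p := by
      rw [Finset.mul_sum]
      exact Finset.sum_congr rfl fun s' _ => by rw [h.inversion _ hp]; ring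
    _ = _ := by rw [hrow, mul_assoc]

theorem apply_eq_of_diagonal (h : FourierOn D I φ N) {E : Matrix T T ℂ}
    (hE : ∀ s ∈ I, ∀ s' ∈ I, s ≠ s' → star (φ s) ⬝ᵥ E *ᵥ φ s' = 0) {p q p' q' : T}
    (hp : p ∈ D) (hq : q ∈ D) (hp' : p' ∈ D) (hq' : q' ∈ D)
    (hc : SameCorrelation I φ p q p' q') : E p q = E p' q' := by
  have hdiag : ∀ r ∈ D, ∀ r' ∈ D, N * N * E r r' =
      ∑ s ∈ I, φ s r * star (φ s r') * (star (φ s) ⬝ᵥ E *ᵥ φ s) := fun r hr r' hr' => by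
    rw [← h.matrix_inversion E hr hr']
    refine Finset.sum_congr rfl fun s hs => Finset.sum_eq_single_of_mem s hs fun s' hs' hne => ?_
    rw [hE s hs s' hs' hne.symm, mul_zero]
  refine mul_left_cancel₀ (mul_ne_zero h.natCast_ne_zero h.natCast_ne_zero) ?_
  rw [hdiag p hp q hq, hdiag p' hp' q' hq']
  exact Finset.sum_congr rfl fun s hs => by rw [hc s hs]

theorem eq_iff_eq_of_sameCorrelation (h : FourierOn D I φ N) {p q p' q' : T} (hp : p ∈ D)
    (hq : q ∈ D) (hp' : p' ∈ D) (hq' : q' ∈ D) (hc : SameCorrelation I φ p q p' q') :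
    p = q ↔ p' = q' := by
  have hsum : (if p = q then (N : ℂ) else 0) = if p' = q' then (N : ℂ) else 0 := by
    rw [← h.recon p hp q hq, ← h.recon p' hp' q' hq']
    exact Finset.sum_congr rfl hc
  have hN := h.natCast_ne_zero
  split_ifs at hsum <;> simp_all

theorem sameCorrelation_diag (h : FourierOn D I φ N) {p p' : T} (hp : p ∈ D) (hp' : p' ∈ D) :
    SameCorrelation I φ p p p' p' := by
  obtain ⟨q', hq', hc⟩ := h.exists_shift p hp p hp p' hp'
  obtain rfl := (h.eq_iff_eq_of_sameCorrelation hp hp hp' hq' hc).1 rfl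
  exact hc

end FourierOn

/-- The family of products `φ s x * φ' s' y`. -/
def prodFamily {T S T' S' : Type*} (φ : S → T → ℂ) (φ' : S' → T' → ℂ) (s : S × S') (p : T × T') :
    ℂ :=
  φ s.1 p.1 * φ' s.2 p.2

theorem dotProduct_prod {T T' : Type*} [Fintype T] [Fintype T'] (f g : T → ℂ) (f' g' : T' → ℂ) :
    (fun p : T × T' => f p.1 * f' p.2) ⬝ᵥ (fun p => g p.1 * g' p.2) =
      (f ⬝ᵥ g) * (f' ⬝ᵥ g') := by
  simp only [dotProduct, Fintype.sum_prod_type, Finset.sum_mul_sum]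
  exact Finset.sum_congr rfl fun _ _ => Finset.sum_congr rfl fun _ _ => mul_mul_mul_comm ..

theorem SameCorrelation.prod {T S T' S' : Type*} {I : Finset S} {φ : S → T → ℂ}
    {I' : Finset S'} {φ' : S' → T' → ℂ} {p q r t : T × T'}
    (h : SameCorrelation I φ p.1 q.1 r.1 t.1) (h' : SameCorrelation I' φ' p.2 q.2 r.2 t.2) :
    SameCorrelation (I ×ˢ I') (prodFamily φ φ') p q r t := fun s hs => by
  simp only [prodFamily, star_mul']
  rw [mul_mul_mul_comm, h _ (Finset.mem_product.1 hs).1, h' _ (Finset.mem_product.1 hs).2,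
    mul_mul_mul_comm]

theorem FourierOn.prod {T S T' S' : Type*} [Fintype T] [DecidableEq T] [Zero S] [DecidableEq S]
    [Fintype T'] [DecidableEq T'] [Zero S'] [DecidableEq S']
    {D : Set T} {I : Finset S} {φ : S → T → ℂ} {N : ℕ}
    {D' : Set T'} {I' : Finset S'} {φ' : S' → T' → ℂ} {N' : ℕ}
    (h : FourierOn D I φ N) (h' : FourierOn D' I' φ' N') :
    FourierOn (D ×ˢ D') (I ×ˢ I') (prodFamily φ φ') (N * N') where
  zero_mem := Finset.mem_product.2 ⟨h.zero_mem, h'.zero_mem⟩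
  pos := mul_ne_zero h.pos h'.pos
  supp s p hp := by
    rcases not_and_or.1 hp with hp | hp
    · rw [prodFamily, h.supp _ _ hp, zero_mul]
    · rw [prodFamily, h'.supp _ _ hp, mul_zero]
  zero_apply p hp := by
    simp [prodFamily, h.zero_apply _ hp.1, h'.zero_apply _ hp.2]
  orth s hs s' hs' := by
    rw [Finset.mem_product] at hs hs'
    have hstar : star (prodFamily φ φ' s) = fun p => star (φ s.1) p.1 * star (φ' s.2) p.2 :=
      funext fun _ => star_mul' ..
    rw [hstar]
    refine (dotProduct_prod ..).trans ?_
    rw [h.orth _ hs.1 _ hs'.1, h'.orth _ hs.2 _ hs'.2]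
    by_cases h1 : s.1 = s'.1 <;> by_cases h2 : s.2 = s'.2 <;> simp [Prod.ext_iff, h1, h2]
  recon p hp q hq := by
    have hsum : ∑ s ∈ I ×ˢ I', prodFamily φ φ' s p * star (prodFamily φ φ' s q) =
        (∑ s ∈ I, φ s p.1 * star (φ s q.1)) * ∑ s ∈ I', φ' s p.2 * star (φ' s q.2) := by
      simp only [prodFamily, star_mul', Finset.sum_product, Finset.sum_mul_sum]
      exact Finset.sum_congr rfl fun _ _ => Finset.sum_congr rfl fun _ _ => mul_mul_mul_comm ..
    rw [hsum, h.recon _ hp.1 _ hq.1, h'.recon _ hp.2 _ hq.2]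
    by_cases h1 : p.1 = q.1 <;> by_cases h2 : p.2 = q.2 <;> simp [Prod.ext_iff, h1, h2]
  exists_shift p hp q hq p' hp' := by
    obtain ⟨u, hu, hc⟩ := h.exists_shift _ hp.1 _ hq.1 _ hp'.1
    obtain ⟨v, hv, hc'⟩ := h'.exists_shift _ hp.2 _ hq.2 _ hp'.2
    exact ⟨(u, v), ⟨hu, hv⟩, SameCorrelation.prod (r := p') (t := (u, v)) hc hc'⟩

theorem isPrimitiveRoot_w {m : ℕ} (hm : m ≠ 0) : IsPrimitiveRoot (w m) m :=
  Complex.isPrimitiveRoot_exp m hm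

theorem w_ne_zero (m : ℕ) : w m ≠ 0 := Complex.exp_ne_zero _

theorem star_w (m : ℕ) : star (w m) = (w m)⁻¹ := by
  rw [w, ← Complex.exp_neg, Complex.star_def, ← Complex.exp_conj]
  simp [neg_div, Complex.conj_ofNat]

theorem w_pow_mul_star_w_pow (m i j : ℕ) : w m ^ i * star (w m ^ j) = w m ^ (i - j : ℤ) := by
  rw [star_pow, star_w, inv_pow, zpow_sub₀ (w_ne_zero m), zpow_natCast, zpow_natCast,
    div_eq_mul_inv]

theorem w_pow_self (m : ℕ) : w m ^ m = 1 := by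
  rcases eq_or_ne m 0 with rfl | hm
  · exact pow_zero _
  · exact (isPrimitiveRoot_w hm).pow_eq_one

theorem w_zpow_eq_of_modEq {m : ℕ} {i j : ℤ} (h : i ≡ j [ZMOD m]) : w m ^ i = w m ^ j := by
  obtain ⟨k, hk⟩ := h.dvd
  rw [show j = i + m * k by omega, zpow_add₀ (w_ne_zero m), zpow_mul, zpow_natCast,
    w_pow_self, one_zpow, mul_one]

theorem sum_w_pow {m i j : ℕ} (hi : i < m) (hj : j < m) :
    ∑ u ∈ Finset.range m, w m ^ (u * i) * star (w m ^ (u * j)) = if i = j then (m : ℂ) else 0 := by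
  have hm : m ≠ 0 := by omega
  have hpow : ∀ u : ℕ, w m ^ (u * i) * star (w m ^ (u * j)) = (w m ^ (i - j : ℤ)) ^ u := fun u => by
    rw [w_pow_mul_star_w_pow, ← zpow_natCast, ← zpow_mul]
    push_cast
    ring_nf
  simp only [hpow]
  split_ifs with hij
  · simp [hij]
  · have hne : w m ^ (i - j : ℤ) ≠ 1 := fun h1 => by
      have := Int.eq_zero_of_abs_lt_dvd (((isPrimitiveRoot_w hm).zpow_eq_one_iff_dvd _).1 h1)
        (abs_lt.2 ⟨by omega, by omega⟩)
      omega
    rw [geom_sum_eq hne, ← zpow_natCast, zpow_comm, zpow_natCast, w_pow_self,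
      one_zpow, sub_self, zero_div]

/-- The Fourier vector `∑_{u < m} w_m^{su} |x + u⟩` on the interval `[x, x + m)`; the vectors
`eta`, `xi`, `beta` and `ket` are all of this form. -/
def four (d x m s : ℕ) : EuclideanSpace ℂ (Fin d) :=
  ∑ u ∈ Finset.range m, w m ^ (s * u) • ket d (x + u)

/-- The indices of the interval `[x, x + m)` in `Fin d`. -/
def ival (d x m : ℕ) : Set (Fin d) := {i | x ≤ i ∧ (i : ℕ) < x + m}

theorem mem_ival {d x m : ℕ} {i : Fin d} : i ∈ ival d x m ↔ x ≤ i ∧ (i : ℕ) < x + m := Iff.rfl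

theorem ket_apply (d t : ℕ) (i : Fin d) : ket d t i = if (i : ℕ) = t then 1 else 0 := rfl

theorem four_apply (d x m s : ℕ) (i : Fin d) :
    four d x m s i = if x ≤ i ∧ (i : ℕ) < x + m then w m ^ (s * (i - x)) else 0 := by
  have hsum : four d x m s i =
      ∑ u ∈ Finset.range m, if (i : ℕ) = x + u then w m ^ (s * u) else 0 := by
    simp [four, ket_apply]
  rw [hsum]
  split_ifs with h
  · rw [Finset.sum_eq_single_of_mem ((i : ℕ) - x) (Finset.mem_range.2 (by omega))
      fun u _ hu => if_neg (by omega), if_pos (by omega)]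
  · refine Finset.sum_eq_zero fun u hu => if_neg ?_
    have := Finset.mem_range.1 hu
    omega

theorem four_apply_of_mem {d x m s : ℕ} {i : Fin d} (hi : i ∈ ival d x m) :
    four d x m s i = w m ^ (s * (i - x)) := (four_apply ..).trans (if_pos hi)

theorem four_apply_of_notMem {d x m s : ℕ} {i : Fin d} (hi : i ∉ ival d x m) :
    four d x m s i = 0 := (four_apply ..).trans (if_neg hi)

theorem eta_eq_four (d n s : ℕ) : eta d n s = four d n (d - 2 * n - 1) s := rfl

theorem xi_eq_four (d n s : ℕ) : xi d n s = four d (n + 1) (d - 2 * n - 1) s := by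
  simp only [xi, four, Nat.add_right_comm n]

theorem beta_eq_four (d n s : ℕ) : beta d n s = four d (n + 1) (d - 2 * n - 2) s := by
  simp only [beta, four, Nat.add_right_comm n]

theorem ket_eq_four (d t : ℕ) : ket d t = four d t 1 0 := by simp [four]

theorem sum_ival {M : Type*} [AddCommMonoid M] {d x m : ℕ} (hd : x + m ≤ d) {f : Fin d → M}
    (hf : ∀ i ∉ ival d x m, f i = 0) :
    ∑ i, f i = ∑ u : Fin m, f ⟨x + u, by omega⟩ := by
  refine (Finset.sum_of_injOn (fun u : Fin m => (⟨x + u, by omega⟩ : Fin d)) ?_ (by simp) ?_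
    fun _ _ => rfl).symm
  · intro u _ v _ huv
    simpa [Fin.ext_iff] using huv
  · refine fun i _ hi => hf i fun hmem => hi ⟨⟨i - x, ?_⟩, by simp, ?_⟩ <;>
      rw [mem_ival] at hmem
    · omega
    · ext; simp; omega

theorem exists_shift_ival {d x m : ℕ} (hd : x + m ≤ d) (i j : Fin d) {i' : Fin d}
    (hi' : i' ∈ ival d x m) : ∃ j' ∈ ival d x m, (i' - j' : ℤ) ≡ i - j [ZMOD m] := by
  rw [mem_ival] at hi'
  have hm : (0 : ℤ) < m := by omega
  have h0 := Int.emod_nonneg (i' + j - i - x : ℤ) hm.ne'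
  have hlt := Int.emod_lt_of_pos (i' + j - i - x : ℤ) hm
  obtain ⟨v, hv⟩ := Int.eq_ofNat_of_zero_le h0
  refine ⟨⟨x + v, by omega⟩, mem_ival.2 ⟨by simp, by simp; omega⟩, ?_⟩
  have hmod : (v : ℤ) ≡ i' + j - i - x [ZMOD m] := hv ▸ Int.mod_modEq _ _
  have := (Int.ModEq.refl (i' - x : ℤ)).sub hmod
  push_cast
  convert this using 1 <;> ring

theorem fourierOn_four {d x m : ℕ} (hm : m ≠ 0) (hd : x + m ≤ d) :
    FourierOn (ival d x m) (Finset.range m) (fun s => (four d x m s).ofLp) m where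
  zero_mem := Finset.mem_range.2 (Nat.pos_of_ne_zero hm)
  pos := hm
  supp _ _ hp := four_apply_of_notMem hp
  zero_apply _ hp := by rw [four_apply_of_mem hp, zero_mul, pow_zero]
  orth s hs s' hs' := by
    rw [Finset.mem_range] at hs hs'
    calc
      _ = ∑ u : Fin m, w m ^ ((u : ℕ) * s') * star (w m ^ ((u : ℕ) * s)) := by
        rw [dotProduct, sum_ival hd fun i hi => by rw [four_apply_of_notMem hi, mul_zero]]
        refine Finset.sum_congr rfl fun u _ => ?_
        have hu : (⟨x + u, by omega⟩ : Fin d) ∈ ival d x m := mem_ival.2 ⟨by simp, by simp⟩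
        rw [Pi.star_apply, four_apply_of_mem hu, four_apply_of_mem hu, mul_comm]
        simp [mul_comm]
      _ = if s = s' then (m : ℂ) else 0 := by
        rw [Fin.sum_univ_eq_sum_range fun u => w m ^ (u * s') * star (w m ^ (u * s)),
          sum_w_pow hs' hs]
        exact if_congr eq_comm rfl rfl
  recon p hp q hq := by
    simp only [four_apply_of_mem hp, four_apply_of_mem hq]
    rw [mem_ival] at hp hq
    rw [sum_w_pow (by omega) (by omega)]
    simp only [Fin.ext_iff]
    congr 1
    simp; omega
  exists_shift p hp q hq p' hp' := by
    obtain ⟨q', hq', hmod⟩ := exists_shift_ival hd p q hp'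
    refine ⟨q', hq', fun s _ => ?_⟩
    simp only [four_apply_of_mem hp, four_apply_of_mem hq, four_apply_of_mem hp',
      four_apply_of_mem hq', w_pow_mul_star_w_pow]
    rw [mem_ival] at hp hq hp' hq'
    refine w_zpow_eq_of_modEq ?_
    push_cast [hp.1, hq.1, hp'.1, hq'.1]
    convert (hmod.mul_left s).symm using 1 <;> ring

/-- The box `[x, x + p) × [y, y + q) × [z, z + r)`. -/
structure Box where
  x : ℕ
  p : ℕ
  y : ℕ
  q : ℕ
  z : ℕ
  r : ℕ

namespace Box

/-- The box is nonempty and contained in `[0, a) × [0, b) × [0, c)`. -/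
structure Valid (B : Box) (a b c : ℕ) : Prop where
  p_ne_zero : B.p ≠ 0
  q_ne_zero : B.q ≠ 0
  r_ne_zero : B.r ≠ 0
  x_add_le : B.x + B.p ≤ a
  y_add_le : B.y + B.q ≤ b
  z_add_le : B.z + B.r ≤ c

/-- The cells of the box. -/
def dom (B : Box) (a b c : ℕ) : Set (Fin a × Fin b × Fin c) :=
  ival a B.x B.p ×ˢ ival b B.y B.q ×ˢ ival c B.z B.r

/-- The frequencies of the product Fourier vectors of the box. -/
def freq (B : Box) : Finset (ℕ × ℕ × ℕ) :=
  Finset.range B.p ×ˢ Finset.range B.q ×ˢ Finset.range B.r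

/-- The product Fourier vector of frequency `s` of the box. -/
def vec (B : Box) (a b c : ℕ) (s : ℕ × ℕ × ℕ) : Tri a b c :=
  triProd (four a B.x B.p s.1) (four b B.y B.q s.2.1) (four c B.z B.r s.2.2)

/-- The product Fourier vectors of the box other than the constant one. -/
def states (B : Box) (a b c : ℕ) : Set (Tri a b c) :=
  B.vec a b c '' {s | s ∈ B.freq ∧ s ≠ 0}

end Box

theorem triProd_apply {a b c : ℕ} (x : EuclideanSpace ℂ (Fin a)) (y : EuclideanSpace ℂ (Fin b))
    (z : EuclideanSpace ℂ (Fin c)) (p : Fin a × Fin b × Fin c) :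
    triProd x y z p = x p.1 * y p.2.1 * z p.2.2 := rfl

namespace Box

variable {a b c : ℕ} {B : Box}

theorem mem_dom {p : Fin a × Fin b × Fin c} : p ∈ B.dom a b c ↔
    (B.x ≤ p.1 ∧ (p.1 : ℕ) < B.x + B.p) ∧ (B.y ≤ p.2.1 ∧ (p.2.1 : ℕ) < B.y + B.q) ∧
      (B.z ≤ p.2.2 ∧ (p.2.2 : ℕ) < B.z + B.r) := Iff.rfl

theorem mem_freq {s : ℕ × ℕ × ℕ} :
    s ∈ B.freq ↔ s.1 < B.p ∧ s.2.1 < B.q ∧ s.2.2 < B.r := by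
  simp [freq]

theorem Valid.fourierOn (h : B.Valid a b c) :
    FourierOn (B.dom a b c) B.freq (fun s => (B.vec a b c s).ofLp) (B.p * (B.q * B.r)) := by
  have hvec : (fun s => (B.vec a b c s).ofLp) = prodFamily (fun s => (four a B.x B.p s).ofLp)
      (prodFamily (fun s => (four b B.y B.q s).ofLp) fun s => (four c B.z B.r s).ofLp) :=
    funext₂ fun _ _ => mul_assoc ..
  rw [hvec]
  exact (fourierOn_four h.p_ne_zero h.x_add_le).prod
    ((fourierOn_four h.q_ne_zero h.y_add_le).prod (fourierOn_four h.r_ne_zero h.z_add_le))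

theorem states_of_p_eq_one (x y q z r : ℕ) : states ⟨x, 1, y, q, z, r⟩ a b c =
    (fun v : ℕ × ℕ => triProd (ket a x) (four b y q v.1) (four c z r v.2)) '' idx q r := by
  ext ψ
  simp [states, freq, vec, idx, ket_eq_four, Prod.ext_iff, and_assoc]

theorem states_of_q_eq_one (x p y z r : ℕ) : states ⟨x, p, y, 1, z, r⟩ a b c =
    (fun v : ℕ × ℕ => triProd (four a x p v.1) (ket b y) (four c z r v.2)) '' idx p r := by
  ext ψ
  simp [states, freq, vec, idx, ket_eq_four, Prod.ext_iff, and_assoc]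

theorem states_of_r_eq_one (x p y q z : ℕ) : states ⟨x, p, y, q, z, 1⟩ a b c =
    (fun v : ℕ × ℕ => triProd (four a x p v.1) (four b y q v.2) (ket c z)) '' idx p q := by
  ext ψ
  simp [states, freq, vec, idx, ket_eq_four, Prod.ext_iff, and_assoc]

end Box

/-- The six tiles of one shell of the cube, named after the corresponding sets of states. -/
inductive ShellTile
  | A1 | A2 | A3 | B1 | B2 | B3
  deriving DecidableEq

instance : Fintype ShellTile where
  elems := {.A1, .A2, .A3, .B1, .B2, .B3}
  complete e := by cases e <;> decide

/-- The box of a tile of the `t`-th shell. -/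
def ShellTile.box (a b c t : ℕ) : ShellTile → Box
  | A1 => ⟨t + 1, a - 2 * t - 1, t, 1, t, c - 2 * t - 1⟩
  | A2 => ⟨t + 1, a - 2 * t - 1, t, b - 2 * t - 1, c - 1 - t, 1⟩
  | A3 => ⟨a - 1 - t, 1, t + 1, b - 2 * t - 1, t, c - 2 * t - 1⟩
  | B1 => ⟨t, a - 2 * t - 1, b - 1 - t, 1, t + 1, c - 2 * t - 1⟩
  | B2 => ⟨t, a - 2 * t - 1, t + 1, b - 2 * t - 1, t, 1⟩
  | B3 => ⟨t, 1, t, b - 2 * t - 1, t + 1, c - 2 * t - 1⟩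

/-- The cube that remains when the shells `0, …, n` are removed. -/
def coreBox (a b c n : ℕ) : Box :=
  ⟨n + 1, a - 2 * n - 2, n + 1, b - 2 * n - 2, n + 1, c - 2 * n - 2⟩

/-- The tiles of the cube: six in each of the shells `0, …, n`, and the core `none`. -/
abbrev Tile (n : ℕ) : Type := Option (Fin (n + 1) × ShellTile)

/-- The box of a tile. -/
def Tile.box (a b c : ℕ) {n : ℕ} : Tile n → Box
  | some (t, e) => e.box a b c t
  | none => coreBox a b c n

theorem ShellTile.sum_univ {M : Type*} [AddCommMonoid M] (f : ShellTile → M) :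
    ∑ e, f e = f A1 + f A2 + f A3 + f B1 + f B2 + f B3 := by
  have : (Finset.univ : Finset ShellTile) = {A1, A2, A3, B1, B2, B3} := rfl
  simp [this, add_assoc]

theorem setF_eq_states (a b c n : ℕ) : setF a b c n = (coreBox a b c n).states a b c := by
  ext ψ
  simp [setF, Box.states, Box.freq, Box.vec, coreBox, beta_eq_four, and_assoc]

theorem iUnion_states_shell (a b c t : ℕ) :
    ⋃ e : ShellTile, (e.box a b c t).states a b c =
      setA1 a b c t ∪ setA2 a b c t ∪ setA3 a b c t ∪
        (setB1 a b c t ∪ setB2 a b c t ∪ setB3 a b c t) := by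
  have huniv (s : ShellTile → Set (Tri a b c)) : ⋃ e, s e =
      s .A1 ∪ s .A2 ∪ s .A3 ∪ (s .B1 ∪ s .B2 ∪ s .B3) := by
    ext ψ
    simp only [Set.mem_iUnion, Set.mem_union]
    constructor
    · rintro ⟨_ | _, h⟩ <;> simp [h]
    · rintro (((h | h) | h) | ((h | h) | h)) <;> exact ⟨_, h⟩
  simp only [huniv, ShellTile.box, Box.states_of_p_eq_one, Box.states_of_q_eq_one,
    Box.states_of_r_eq_one, setA1, setA2, setA3, setB1, setB2, setB3, xi_eq_four, eta_eq_four]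

theorem setU_eq (a b c n : ℕ) : setU a b c n =
    insert (stopper a b c) (⋃ k : Tile n, (k.box a b c).states a b c) := by
  simp only [setU, ← iUnion_states_shell, setF_eq_states]
  ext ψ
  simp [Tile.box, Option.exists, Fin.exists_iff, or_comm]

section Construction

variable {a b c n : ℕ}

theorem Tile.valid (ha : 2 * n + 3 ≤ a) (hb : 2 * n + 3 ≤ b) (hc : 2 * n + 3 ≤ c) (k : Tile n) :
    (k.box a b c).Valid a b c := by
  rcases k with _ | ⟨t, _ | _⟩ <;> constructor <;>
    simp only [Tile.box, coreBox, ShellTile.box] <;> omega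

theorem ShellTile.eq_of_mem_dom {s t : ℕ} {e f : ShellTile} (ha : 2 * t + 3 ≤ a)
    (hb : 2 * t + 3 ≤ b) (hc : 2 * t + 3 ≤ c) (hst : s ≤ t) {p : Fin a × Fin b × Fin c}
    (hp : p ∈ (e.box a b c s).dom a b c) (hp' : p ∈ (f.box a b c t).dom a b c) :
    s = t ∧ e = f := by
  rw [Box.mem_dom] at hp hp'
  cases e <;> simp only [ShellTile.box] at hp <;> cases f <;> simp only [ShellTile.box] at hp' <;>
    first
    | exact ⟨by omega, rfl⟩
    | omega

theorem ShellTile.notMem_dom_of_mem_coreBox {t : ℕ} (e : ShellTile) (ht : t ≤ n)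
    {p : Fin a × Fin b × Fin c} (hp : p ∈ (coreBox a b c n).dom a b c) :
    p ∉ (e.box a b c t).dom a b c := fun hp' => by
  rw [Box.mem_dom] at hp hp'
  simp only [coreBox] at hp
  cases e <;> simp only [ShellTile.box] at hp' <;> omega

theorem Tile.eq_of_mem_dom (ha : 2 * n + 3 ≤ a) (hb : 2 * n + 3 ≤ b) (hc : 2 * n + 3 ≤ c)
    {k l : Tile n} {p : Fin a × Fin b × Fin c} (hk : p ∈ (k.box a b c).dom a b c)
    (hl : p ∈ (l.box a b c).dom a b c) : k = l := by
  rcases k with _ | ⟨s, e⟩ <;> rcases l with _ | ⟨t, f⟩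
  · rfl
  · exact absurd hl (f.notMem_dom_of_mem_coreBox (by omega) hk)
  · exact absurd hk (e.notMem_dom_of_mem_coreBox (by omega) hl)
  · rcases le_total (s : ℕ) t with hst | hst
    · obtain ⟨h, rfl⟩ := ShellTile.eq_of_mem_dom (by omega) (by omega) (by omega) hst hk hl
      rw [Fin.ext h]
    · obtain ⟨h, rfl⟩ := ShellTile.eq_of_mem_dom (by omega) (by omega) (by omega) hst hl hk
      rw [Fin.ext h]

theorem inner_eq_star_dotProduct {ι : Type*} [Fintype ι] (ψ φ : EuclideanSpace ℂ ι) :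
    inner ℂ ψ φ = star ψ.ofLp ⬝ᵥ φ.ofLp :=
  (EuclideanSpace.inner_eq_star_dotProduct ψ φ).trans (dotProduct_comm _ _)

theorem stopper_apply (p : Fin a × Fin b × Fin c) : stopper a b c p = 1 := by
  have hsum {d : ℕ} (i : Fin d) : (∑ j ∈ Finset.range d, ket d j) i = 1 := by simp [ket_apply]
  rw [stopper, triProd_apply, hsum, hsum, hsum, one_mul, one_mul]

theorem stopper_ne_zero (ha : 0 < a) (hb : 0 < b) (hc : 0 < c) : stopper a b c ≠ 0 := fun h => by
  have := stopper_apply (⟨0, ha⟩, ⟨0, hb⟩, ⟨0, hc⟩)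
  simp [h] at this

theorem inner_stopper (ψ : Tri a b c) : inner ℂ (stopper a b c) ψ = ∑ p, ψ p := by
  simp [inner_eq_star_dotProduct, dotProduct, stopper_apply]

theorem Box.Valid.vec_ne_zero {B : Box} (h : B.Valid a b c) {s : ℕ × ℕ × ℕ} (hs : s ∈ B.freq) :
    B.vec a b c s ≠ 0 := fun h0 => by
  have := h.fourierOn.orth s hs s hs
  rw [if_pos rfl, h0] at this
  exact h.fourierOn.natCast_ne_zero (by simpa using this.symm)

/-- A label of a product Fourier vector of the tiling: a tile and a frequency. -/
abbrev Label (n : ℕ) : Type := Σ _ : Tile n, ℕ × ℕ × ℕ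

/-- The vector with a given label. -/
def Label.vec (a b c : ℕ) (l : Label n) : Tri a b c := (l.1.box a b c).vec a b c l.2

/-- The labels of the states of `setU` other than the stopper. -/
def labels (a b c n : ℕ) : Finset (Label n) :=
  Finset.univ.sigma fun k => (k.box a b c).freq.erase 0

theorem mem_labels {l : Label n} :
    l ∈ labels a b c n ↔ l.2 ≠ 0 ∧ l.2 ∈ (l.1.box a b c).freq := by
  simp [labels]

theorem setU_eq_insert_image (a b c n : ℕ) :
    setU a b c n =
      insert (stopper a b c) (Label.vec a b c '' (labels a b c n : Set (Label n))) := by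
  ext ψ
  simp [setU_eq, mem_labels, Box.states, Label.vec, and_comm]

theorem mem_setU {ψ : Tri a b c} : ψ ∈ setU a b c n ↔
    ψ = stopper a b c ∨ ∃ l ∈ labels a b c n, l.vec a b c = ψ := by
  rw [setU_eq_insert_image]
  rfl

theorem finite_setU (a b c n : ℕ) : (setU a b c n).Finite := by
  rw [setU_eq_insert_image]
  exact ((Finset.finite_toSet _).image _).insert _

section

variable (ha : 2 * n + 3 ≤ a) (hb : 2 * n + 3 ≤ b) (hc : 2 * n + 3 ≤ c)
include ha hb hc

theorem inner_stopper_label {l : Label n} (hl : l ∈ labels a b c n) :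
    inner ℂ (stopper a b c) (l.vec a b c) = 0 :=
  (inner_stopper _).trans
    ((l.1.valid ha hb hc).fourierOn.sum_eq_zero (mem_labels.1 hl).2 (mem_labels.1 hl).1)

theorem Label.vec_ne_zero {l : Label n} (hl : l ∈ labels a b c n) : l.vec a b c ≠ 0 :=
  (l.1.valid ha hb hc).vec_ne_zero (mem_labels.1 hl).2

theorem inner_label_label {l l' : Label n} (hl : l ∈ labels a b c n) (hl' : l' ∈ labels a b c n)
    (hne : l ≠ l') : inner ℂ (l.vec a b c) (l'.vec a b c) = 0 := by
  obtain ⟨k, s⟩ := l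
  obtain ⟨k', s'⟩ := l'
  have hk := (k.valid ha hb hc).fourierOn
  have hk' := (k'.valid ha hb hc).fourierOn
  rw [inner_eq_star_dotProduct]
  obtain rfl | hkk := eq_or_ne k k'
  · refine (hk.orth s (mem_labels.1 hl).2 s' (mem_labels.1 hl').2).trans (if_neg ?_)
    rintro rfl
    exact hne rfl
  · refine Finset.sum_eq_zero fun p _ => ?_
    by_cases hp : p ∈ (k.box a b c).dom a b c
    · exact mul_eq_zero_of_right _
        (hk'.supp _ p fun hp' => hkk (Tile.eq_of_mem_dom ha hb hc hp hp'))
    · exact mul_eq_zero_of_left (star_eq_zero.2 (hk.supp _ p hp)) _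

theorem isOPS_setU : IsOPS (setU a b c n) := by
  constructor
  · intro ψ hψ
    rcases mem_setU.1 hψ with rfl | ⟨l, hl, rfl⟩
    · exact ⟨stopper_ne_zero (by omega) (by omega) (by omega), _, _, _, rfl⟩
    · exact ⟨Label.vec_ne_zero ha hb hc hl, _, _, _, rfl⟩
  · intro ψ hψ φ hφ hne
    rcases mem_setU.1 hψ with rfl | ⟨l, hl, rfl⟩ <;> rcases mem_setU.1 hφ with rfl | ⟨l', hl', rfl⟩
    · exact absurd rfl hne
    · exact inner_stopper_label ha hb hc hl'
    · exact inner_eq_zero_symm.1 (inner_stopper_label ha hb hc hl)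
    · exact inner_label_label ha hb hc hl hl' (ne_of_apply_ne _ hne)

theorem injOn_label_vec : Set.InjOn (Label.vec a b c) (labels a b c n : Set (Label n)) := by
  intro l hl l' hl' heq
  by_contra hne
  have horth := inner_label_label ha hb hc hl hl' hne
  rw [← heq, inner_self_eq_zero] at horth
  exact Label.vec_ne_zero ha hb hc hl horth

theorem stopper_notMem_image :
    stopper a b c ∉ Label.vec a b c '' (labels a b c n : Set (Label n)) := by
  rintro ⟨l, hl, heq⟩
  have horth := inner_stopper_label ha hb hc hl
  rw [heq, inner_self_eq_zero] at horth
  exact stopper_ne_zero (by omega) (by omega) (by omega) horth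

end

theorem sum_shell_volumes (a b c : ℤ) (n : ℕ) :
    ∑ t ∈ Finset.range (n + 1), (2 * ((a - 2 * t - 1) * (b - 2 * t - 1)
      + (b - 2 * t - 1) * (c - 2 * t - 1) + (a - 2 * t - 1) * (c - 2 * t - 1)) - 6)
    = a * b * c - (a - 2 * n - 2) * (b - 2 * n - 2) * (c - 2 * n - 2) - 8 * (n + 1) := by
  induction n with
  | zero => simp; ring
  | succ n ih => rw [Finset.sum_range_succ, ih]; push_cast; ring

theorem Box.Valid.card_freq_erase {B : Box} (h : B.Valid a b c) :
    ((B.freq.erase 0).card : ℤ) = B.p * (B.q * B.r) - 1 := by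
  have := Finset.card_erase_add_one h.fourierOn.zero_mem
  have hcard : B.freq.card = B.p * (B.q * B.r) := by simp [Box.freq]
  rw [hcard] at this
  zify at this
  linarith

theorem card_labels (ha : 2 * n + 3 ≤ a) (hb : 2 * n + 3 ≤ b) (hc : 2 * n + 3 ≤ c) :
    ((labels a b c n).card : ℤ) = (a : ℤ) * b * c - 8 * (n + 1) - 1 := by
  have hsub : ∀ d t k : ℕ, 2 * t + k ≤ d → ((d - 2 * t - k : ℕ) : ℤ) = d - 2 * t - k := by
    intros; omega
  have hshell : ∀ t : Fin (n + 1),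
      ∑ e : ShellTile, (((e.box a b c t).p : ℤ) * ((e.box a b c t).q * (e.box a b c t).r) - 1) =
        2 * ((a - 2 * t - 1) * (b - 2 * t - 1) + (b - 2 * t - 1) * (c - 2 * t - 1)
          + (a - 2 * t - 1) * (c - 2 * t - 1)) - 6 := fun t => by
    simp only [ShellTile.sum_univ, ShellTile.box]
    rw [hsub a t 1 (by omega), hsub b t 1 (by omega), hsub c t 1 (by omega)]
    push_cast
    ring
  have hsum := sum_shell_volumes a b c n
  rw [Finset.sum_range] at hsum
  rw [labels, Finset.card_sigma, Nat.cast_sum, Finset.sum_congr rfl fun k _ =>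
    (Tile.valid ha hb hc k).card_freq_erase, Fintype.sum_option, Fintype.sum_prod_type]
  simp only [Tile.box, hshell, hsum, coreBox]
  rw [hsub a n 2 (by omega), hsub b n 2 (by omega), hsub c n 2 (by omega)]
  ring

theorem ncard_setU (ha : 2 * n + 3 ≤ a) (hb : 2 * n + 3 ≤ b) (hc : 2 * n + 3 ≤ c) :
    ((setU a b c n).ncard : ℤ) = (a : ℤ) * b * c - 8 * (n + 1) := by
  rw [setU_eq_insert_image, Set.ncard_insert_of_notMem (stopper_notMem_image ha hb hc),
    (injOn_label_vec ha hb hc).ncard_image, Set.ncard_coe_finset, Nat.cast_add,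
    card_labels ha hb hc]
  simp

theorem span_setU_ne_top (ha : 2 * n + 3 ≤ a) (hb : 2 * n + 3 ≤ b) (hc : 2 * n + 3 ≤ c) :
    Submodule.span ℂ (setU a b c n) ≠ ⊤ := fun htop => by
  let := (finite_setU a b c n).fintype
  have hdim := finrank_span_le_card (R := ℂ) (setU a b c n)
  rw [htop, finrank_top, finrank_euclideanSpace, ← Set.ncard_eq_toFinset_card'] at hdim
  have hcard := ncard_setU ha hb hc
  simp only [Fintype.card_prod, Fintype.card_fin] at hdim
  zify at hdim
  rw [← mul_assoc] at hdim
  omega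

end Construction

/-- `f` is a nonzero constant on `s`. -/
def ConstNeZeroOn {α : Type*} (f : α → ℂ) (s : Finset α) : Prop := ∃ c ≠ 0, ∀ i ∈ s, f i = c

/-- The alternatives for `f` and `g` when `f i * g j` is constant on `s × t`: one of them vanishes,
or both are nonzero constants. -/
def ProductConst {α β : Type*} (f : α → ℂ) (s : Finset α) (g : β → ℂ) (t : Finset β) : Prop :=
  (∀ i ∈ s, f i = 0) ∨ (∀ j ∈ t, g j = 0) ∨ ConstNeZeroOn f s ∧ ConstNeZeroOn g t

theorem ConstNeZeroOn.ne_zero {α : Type*} {f : α → ℂ} {s : Finset α} (h : ConstNeZeroOn f s)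
    {i : α} (hi : i ∈ s) : f i ≠ 0 := by
  obtain ⟨c, hc, hf⟩ := h
  exact hf i hi ▸ hc

theorem ConstNeZeroOn.sum_ne_zero {α : Type*} {f : α → ℂ} {s : Finset α} (h : ConstNeZeroOn f s)
    (hs : s.Nonempty) : ∑ i ∈ s, f i ≠ 0 := by
  obtain ⟨c, hc, hf⟩ := h
  rw [Finset.sum_congr rfl hf, Finset.sum_const, nsmul_eq_mul]
  exact mul_ne_zero (Nat.cast_ne_zero.2 hs.card_ne_zero) hc

theorem productConst_of_const {α β : Type*} {f : α → ℂ} {s : Finset α} {g : β → ℂ} {t : Finset β}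
    (h : ∀ i ∈ s, ∀ j ∈ t, ∀ i' ∈ s, ∀ j' ∈ t, f i * g j = f i' * g j') : ProductConst f s g t := by
  by_cases hf : ∀ i ∈ s, f i = 0
  · exact .inl hf
  by_cases hg : ∀ j ∈ t, g j = 0
  · exact .inr (.inl hg)
  push Not at hf hg
  obtain ⟨i, hi, hfi⟩ := hf
  obtain ⟨j, hj, hgj⟩ := hg
  exact .inr (.inr ⟨⟨f i, hfi, fun i' hi' => mul_right_cancel₀ hgj (h i' hi' j hj i hi j hj)⟩,
    ⟨g j, hgj, fun j' hj' => mul_left_cancel₀ hfi (h i hi j' hj' i hi j hj)⟩⟩)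

/-- The trace of a shell on one axis: a finite set with two end points and a further point. -/
structure Layer (α : Type*) where
  carrier : Finset α
  lo : α
  hi : α
  mid : α
  lo_mem : lo ∈ carrier
  hi_mem : hi ∈ carrier
  mid_mem : mid ∈ carrier
  lo_ne_hi : lo ≠ hi
  mid_ne_lo : mid ≠ lo
  mid_ne_hi : mid ≠ hi

namespace Layer

variable {α : Type*}

/-- Exchange the two end points. -/
def flip (L : Layer α) : Layer α where
  __ := L
  lo := L.hi
  hi := L.lo
  lo_mem := L.hi_mem
  hi_mem := L.lo_mem
  lo_ne_hi := L.lo_ne_hi.symm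
  mid_ne_lo := L.mid_ne_hi
  mid_ne_hi := L.mid_ne_lo

variable [DecidableEq α]

/-- The layer without its lower end point. -/
def upper (L : Layer α) : Finset α := L.carrier.erase L.lo

/-- The layer without its upper end point. -/
def lower (L : Layer α) : Finset α := L.carrier.erase L.hi

variable (L : Layer α)

theorem mid_mem_upper : L.mid ∈ L.upper := Finset.mem_erase.2 ⟨L.mid_ne_lo, L.mid_mem⟩

theorem mid_mem_lower : L.mid ∈ L.lower := Finset.mem_erase.2 ⟨L.mid_ne_hi, L.mid_mem⟩

theorem hi_mem_upper : L.hi ∈ L.upper := Finset.mem_erase.2 ⟨L.lo_ne_hi.symm, L.hi_mem⟩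

theorem lo_mem_lower : L.lo ∈ L.lower := Finset.mem_erase.2 ⟨L.lo_ne_hi, L.lo_mem⟩

variable {L} {f : α → ℂ}

theorem hi_ne_zero (hf : ∃ i ∈ L.carrier, f i ≠ 0) (h : ∀ i ∈ L.lower, f i = 0) : f L.hi ≠ 0 := by
  obtain ⟨i, hi, hfi⟩ := hf
  by_contra h0
  by_cases hih : i = L.hi
  · exact hfi (hih ▸ h0)
  · exact hfi (h i (Finset.mem_erase.2 ⟨hih, hi⟩))

theorem lo_ne_zero (hf : ∃ i ∈ L.carrier, f i ≠ 0) (h : ∀ i ∈ L.upper, f i = 0) : f L.lo ≠ 0 :=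
  L.flip.hi_ne_zero hf h

theorem add_sum_lower (f : α → ℂ) : f L.hi + ∑ i ∈ L.lower, f i = ∑ i ∈ L.carrier, f i :=
  Finset.add_sum_erase _ _ L.hi_mem

theorem not_forall_lower_eq_zero (hf : ∃ i ∈ L.carrier, f i ≠ 0)
    (hsum : ∑ i ∈ L.carrier, f i = 0) : ¬ ∀ i ∈ L.lower, f i = 0 := fun h => by
  rw [← L.add_sum_lower, Finset.sum_eq_zero h, add_zero] at hsum
  exact hi_ne_zero hf h hsum

theorem not_forall_upper_eq_zero (hf : ∃ i ∈ L.carrier, f i ≠ 0)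
    (hsum : ∑ i ∈ L.carrier, f i = 0) : ¬ ∀ i ∈ L.upper, f i = 0 :=
  L.flip.not_forall_lower_eq_zero hf hsum

theorem hi_ne_zero_of_constNeZeroOn (hsum : ∑ i ∈ L.carrier, f i = 0)
    (h : ConstNeZeroOn f L.lower) : f L.hi ≠ 0 := fun h0 => by
  rw [← L.add_sum_lower, h0, zero_add] at hsum
  exact h.sum_ne_zero ⟨_, L.mid_mem_lower⟩ hsum

theorem not_constNeZeroOn_upper (hsum : ∑ i ∈ L.carrier, f i = 0)
    (h : ConstNeZeroOn f L.lower) : ¬ ConstNeZeroOn f L.upper := by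
  rintro ⟨c, hc, hup⟩
  obtain ⟨d, hd, hlow⟩ := h
  obtain rfl : c = d := (hup _ L.mid_mem_upper).symm.trans (hlow _ L.mid_mem_lower)
  have hall : ConstNeZeroOn f L.carrier := ⟨c, hc, fun i hi => by
    by_cases hil : i = L.lo
    · exact hil ▸ hlow _ L.lo_mem_lower
    · exact hup i (Finset.mem_erase.2 ⟨hil, hi⟩)⟩
  exact hall.sum_ne_zero ⟨_, L.mid_mem⟩ hsum

end Layer

/-- The constraints on `x ⊗ y ⊗ z` imposed by the six tiles of a shell whose traces on the axes
are `L`, `M`, `N`. -/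
structure ShellConst {α β γ : Type*} [DecidableEq α] [DecidableEq β] [DecidableEq γ]
    (L : Layer α) (M : Layer β) (N : Layer γ) (x : α → ℂ) (y : β → ℂ) (z : γ → ℂ) : Prop where
  x_lo : x L.lo ≠ 0 → ProductConst y M.lower z N.upper
  x_hi : x L.hi ≠ 0 → ProductConst y M.upper z N.lower
  y_lo : y M.lo ≠ 0 → ProductConst z N.lower x L.upper
  y_hi : y M.hi ≠ 0 → ProductConst z N.upper x L.lower
  z_lo : z N.lo ≠ 0 → ProductConst x L.lower y M.upper
  z_hi : z N.hi ≠ 0 → ProductConst x L.upper y M.lower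

namespace ShellConst

variable {α β γ : Type*} [DecidableEq α] [DecidableEq β] [DecidableEq γ] {L : Layer α}
  {M : Layer β} {N : Layer γ} {x : α → ℂ} {y : β → ℂ} {z : γ → ℂ}

theorem flip (h : ShellConst L M N x y z) : ShellConst L.flip M.flip N.flip x y z :=
  ⟨h.x_hi, h.x_lo, h.y_hi, h.y_lo, h.z_hi, h.z_lo⟩

variable (h : ShellConst L M N x y z) (hx : ∃ i ∈ L.carrier, x i ≠ 0)
  (hy : ∃ j ∈ M.carrier, y j ≠ 0) (hz : ∃ k ∈ N.carrier, z k ≠ 0)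
  (hsum : ∑ i ∈ L.carrier, x i = 0)
include h hx hy hz hsum

theorem not_constNeZeroOn_lower : ¬ ConstNeZeroOn x L.lower := fun hxL => by
  have hxU := Layer.not_constNeZeroOn_upper hsum hxL
  have hxU0 := Layer.not_forall_upper_eq_zero hx hsum
  have hy_lo : y M.lo ≠ 0 → ∀ k ∈ N.lower, z k = 0 := fun h0 => by
    rcases h.y_lo h0 with hz0 | hx0 | ⟨-, hc⟩
    exacts [hz0, absurd hx0 hxU0, absurd hc hxU]
  have hz_hi : z N.hi ≠ 0 → ∀ j ∈ M.lower, y j = 0 := fun h0 => by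
    rcases h.z_hi h0 with hx0 | hy0 | ⟨hc, -⟩
    exacts [absurd hx0 hxU0, hy0, absurd hc hxU]
  rcases h.x_hi (Layer.hi_ne_zero_of_constNeZeroOn hsum hxL) with hy0 | hz0 | ⟨hyU, hzL⟩
  · have hlo := Layer.lo_ne_zero hy hy0
    exact hlo (hz_hi (Layer.hi_ne_zero hz (hy_lo hlo)) _ M.lo_mem_lower)
  · have hhi := Layer.hi_ne_zero hz hz0
    rcases h.y_hi (Layer.hi_ne_zero hy (hz_hi hhi)) with hz0' | hx0 | ⟨hc, -⟩
    · exact hhi (hz0' _ N.hi_mem_upper)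
    · exact Layer.not_forall_lower_eq_zero hx hsum hx0
    · exact hc.ne_zero N.mid_mem_upper (hz0 _ N.mid_mem_lower)
  · rcases h.x_lo (hxL.ne_zero L.lo_mem_lower) with hy0 | hz0 | ⟨hyL, -⟩
    · exact hyU.ne_zero M.mid_mem_upper (hy0 _ M.mid_mem_lower)
    · exact hzL.ne_zero N.mid_mem_lower (hz0 _ N.mid_mem_upper)
    · exact hzL.ne_zero N.mid_mem_lower
        (hy_lo (hyL.ne_zero M.lo_mem_lower) _ N.mid_mem_lower)

theorem not_constNeZeroOn_upper : ¬ ConstNeZeroOn x L.upper :=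
  h.flip.not_constNeZeroOn_lower hx hy hz hsum

theorem y_lo_eq_zero : y M.lo = 0 := by
  by_contra hlo
  rcases h.y_lo hlo with hz0 | hx0 | ⟨-, hc⟩
  · rcases h.z_hi (Layer.hi_ne_zero hz hz0) with hx0 | hy0 | ⟨hc, -⟩
    · exact Layer.not_forall_upper_eq_zero hx hsum hx0
    · exact hlo (hy0 _ M.lo_mem_lower)
    · exact h.not_constNeZeroOn_upper hx hy hz hsum hc
  · exact Layer.not_forall_upper_eq_zero hx hsum hx0
  · exact h.not_constNeZeroOn_upper hx hy hz hsum hc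

theorem y_hi_eq_zero : y M.hi = 0 := h.flip.y_lo_eq_zero hx hy hz hsum

theorem z_lo_eq_zero : z N.lo = 0 := by
  by_contra hlo
  rcases h.z_lo hlo with hx0 | hy0 | ⟨hc, -⟩
  · exact Layer.not_forall_lower_eq_zero hx hsum hx0
  · exact Layer.lo_ne_zero hy hy0 (h.y_lo_eq_zero hx hy hz hsum)
  · exact h.not_constNeZeroOn_lower hx hy hz hsum hc

theorem z_hi_eq_zero : z N.hi = 0 := h.flip.z_lo_eq_zero hx hy hz hsum

theorem x_lo_eq_zero : x L.lo = 0 := by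
  by_contra hlo
  rcases h.x_lo hlo with hy0 | hz0 | ⟨hc, -⟩
  · exact Layer.hi_ne_zero hy hy0 (h.y_hi_eq_zero hx hy hz hsum)
  · exact Layer.lo_ne_zero hz hz0 (h.z_lo_eq_zero hx hy hz hsum)
  · exact hc.ne_zero M.lo_mem_lower (h.y_lo_eq_zero hx hy hz hsum)

theorem x_hi_eq_zero : x L.hi = 0 := h.flip.x_lo_eq_zero hx hy hz hsum

end ShellConst

/-- The layer `[t, d - t)` of the `t`-th shell. -/
def axisLayer (d t : ℕ) (h : 2 * t + 3 ≤ d) : Layer (Fin d) where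
  carrier := {i | t ≤ (i : ℕ) ∧ (i : ℕ) < d - t}
  lo := ⟨t, by omega⟩
  hi := ⟨d - 1 - t, by omega⟩
  mid := ⟨t + 1, by omega⟩
  lo_mem := by simp; omega
  hi_mem := by simp; omega
  mid_mem := by simp; omega
  lo_ne_hi := by simp; omega
  mid_ne_lo := by simp
  mid_ne_hi := by simp; omega

section axisLayer

variable {d t : ℕ} (h : 2 * t + 3 ≤ d) {i : Fin d}

theorem mem_axisLayer : i ∈ (axisLayer d t h).carrier ↔ t ≤ (i : ℕ) ∧ (i : ℕ) < d - t := by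
  simp [axisLayer]

theorem mem_axisLayer_upper :
    i ∈ (axisLayer d t h).upper ↔ t + 1 ≤ (i : ℕ) ∧ (i : ℕ) < d - t := by
  simp [Layer.upper, axisLayer, Fin.ext_iff]
  omega

theorem mem_axisLayer_lower :
    i ∈ (axisLayer d t h).lower ↔ t ≤ (i : ℕ) ∧ (i : ℕ) < d - 1 - t := by
  simp [Layer.lower, axisLayer, Fin.ext_iff]
  omega

/-- `f` vanishes outside `[t, d - t)`. -/
def VanishesOutside (t : ℕ) (f : Fin d → ℂ) : Prop :=
  ∀ i : Fin d, ¬ (t ≤ (i : ℕ) ∧ (i : ℕ) < d - t) → f i = 0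

variable {f : Fin d → ℂ}

theorem vanishesOutside_zero : VanishesOutside 0 f := fun i hi => absurd ⟨by omega, by omega⟩ hi

theorem VanishesOutside.succ (hf : VanishesOutside t f) (hlo : f (axisLayer d t h).lo = 0)
    (hhi : f (axisLayer d t h).hi = 0) : VanishesOutside (t + 1) f := fun i hi => by
  by_cases h1 : (i : ℕ) = t
  · exact (congrArg f (Fin.ext h1)).trans hlo
  by_cases h2 : (i : ℕ) = d - 1 - t
  · exact (congrArg f (Fin.ext h2)).trans hhi
  · exact hf i (by omega)

theorem VanishesOutside.exists_ne_zero (hf : VanishesOutside t f) (h0 : f ≠ 0) :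
    ∃ i : Fin d, (t ≤ (i : ℕ) ∧ (i : ℕ) < d - t) ∧ f i ≠ 0 := by
  obtain ⟨i, hi⟩ := Function.ne_iff.1 h0
  exact ⟨i, by_contra fun hn => hi (hf i hn), hi⟩

theorem VanishesOutside.sum_axisLayer (hf : VanishesOutside t f) :
    ∑ i ∈ (axisLayer d t h).carrier, f i = ∑ i, f i :=
  Finset.sum_subset (Finset.subset_univ _) fun i _ hi =>
    hf i fun hi' => hi ((mem_axisLayer h).2 hi')

end axisLayer

section Rotation

variable {a b c n : ℕ}

/-- Cyclic permutation of the three axes. -/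
def Box.rotate (B : Box) : Box := ⟨B.y, B.q, B.z, B.r, B.x, B.p⟩

/-- The tile to which the cyclic permutation of the axes moves a given tile. -/
def ShellTile.rotate : ShellTile → ShellTile
  | A1 => B3
  | B3 => B2
  | B2 => A1
  | A2 => B1
  | B1 => A3
  | A3 => A2

/-- The tile to which the cyclic permutation of the axes moves a given tile; the core is fixed. -/
def Tile.rotate : Tile n → Tile n := Option.map (Prod.map id ShellTile.rotate)

theorem Tile.rotate_surjective : Function.Surjective (Tile.rotate (n := n)) := by
  have h : ∀ e : ShellTile, e.rotate.rotate.rotate = e := by rintro (_ | _) <;> rfl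
  rintro (_ | ⟨t, e⟩)
  · exact ⟨none, rfl⟩
  · exact ⟨some (t, e.rotate.rotate), congrArg (fun e => some (t, e)) (h e)⟩

theorem Tile.box_rotate (k : Tile n) : k.rotate.box b c a = (k.box a b c).rotate := by
  rcases k with _ | ⟨t, _ | _⟩ <;> rfl

theorem Box.mem_dom_rotate {B : Box} {i : Fin a} {j : Fin b} {k : Fin c} :
    (j, k, i) ∈ B.rotate.dom b c a ↔ (i, j, k) ∈ B.dom a b c := by
  simp only [mem_dom, rotate]
  tauto

end Rotation

section Unextendible

variable {a b c n : ℕ}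

/-- `x ⊗ y ⊗ z` is constant on every tile. -/
def TileConst (n : ℕ) (x : Fin a → ℂ) (y : Fin b → ℂ) (z : Fin c → ℂ) : Prop :=
  ∀ k : Tile n, ∀ p ∈ (k.box a b c).dom a b c, ∀ q ∈ (k.box a b c).dom a b c,
    x p.1 * y p.2.1 * z p.2.2 = x q.1 * y q.2.1 * z q.2.2

namespace TileConst

variable {x : Fin a → ℂ} {y : Fin b → ℂ} {z : Fin c → ℂ}

theorem rotate (h : TileConst n x y z) : TileConst n y z x := by
  rintro k ⟨j, l, i⟩ hp ⟨j', l', i'⟩ hq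
  have hdom {i j l} (hp : (j, l, i) ∈ (k.box b c a).dom b c a) :
      (i, j, l) ∈ (k.rotate.rotate.box a b c).dom a b c := by
    rw [Tile.box_rotate, Tile.box_rotate]
    exact Box.mem_dom_rotate.2 (Box.mem_dom_rotate.2 hp)
  linear_combination h _ _ (hdom hp) _ (hdom hq)

section Shell

variable {t : ℕ} (ha : 2 * t + 3 ≤ a) (hb : 2 * t + 3 ≤ b) (hc : 2 * t + 3 ≤ c)

theorem productConst_lo (h : TileConst n x y z) (ht : t ≤ n) (h0 : x (axisLayer a t ha).lo ≠ 0) :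
    ProductConst y (axisLayer b t hb).lower z (axisLayer c t hc).upper := by
  refine productConst_of_const fun j hj l hl j' hj' l' hl' => mul_left_cancel₀ h0 ?_
  rw [mem_axisLayer_lower] at hj hj'
  rw [mem_axisLayer_upper] at hl hl'
  have := h (some (⟨t, by omega⟩, .B3)) ((axisLayer a t ha).lo, j, l) ?_
    ((axisLayer a t ha).lo, j', l') ?_
  · linear_combination this
  all_goals simp only [Box.mem_dom, Tile.box, ShellTile.box, axisLayer]; omega

theorem productConst_hi (h : TileConst n x y z) (ht : t ≤ n) (h0 : x (axisLayer a t ha).hi ≠ 0) :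
    ProductConst y (axisLayer b t hb).upper z (axisLayer c t hc).lower := by
  refine productConst_of_const fun j hj l hl j' hj' l' hl' => mul_left_cancel₀ h0 ?_
  rw [mem_axisLayer_upper] at hj hj'
  rw [mem_axisLayer_lower] at hl hl'
  have := h (some (⟨t, by omega⟩, .A3)) ((axisLayer a t ha).hi, j, l) ?_
    ((axisLayer a t ha).hi, j', l') ?_
  · linear_combination this
  all_goals simp only [Box.mem_dom, Tile.box, ShellTile.box, axisLayer]; omega

theorem shellConst (h : TileConst n x y z) (ht : t ≤ n) :
    ShellConst (axisLayer a t ha) (axisLayer b t hb) (axisLayer c t hc) x y z where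
  x_lo := h.productConst_lo ha hb hc ht
  x_hi := h.productConst_hi ha hb hc ht
  y_lo := h.rotate.productConst_lo hb hc ha ht
  y_hi := h.rotate.productConst_hi hb hc ha ht
  z_lo := h.rotate.rotate.productConst_lo hc ha hb ht
  z_hi := h.rotate.rotate.productConst_hi hc ha hb ht

end Shell

variable (ha : 2 * n + 3 ≤ a) (hb : 2 * n + 3 ≤ b) (hc : 2 * n + 3 ≤ c)
include ha hb hc

theorem vanishesOutside (h : TileConst n x y z) (hx : x ≠ 0) (hy : y ≠ 0) (hz : z ≠ 0)
    (hsum : ∑ i, x i = 0) {t : ℕ} (ht : t ≤ n + 1) :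
    VanishesOutside t x ∧ VanishesOutside t y ∧ VanishesOutside t z := by
  induction t with
  | zero => exact ⟨vanishesOutside_zero, vanishesOutside_zero, vanishesOutside_zero⟩
  | succ t ih =>
    obtain ⟨ihx, ihy, ihz⟩ := ih (by omega)
    have hat : 2 * t + 3 ≤ a := by omega
    have hbt : 2 * t + 3 ≤ b := by omega
    have hct : 2 * t + 3 ≤ c := by omega
    have hshell := h.shellConst hat hbt hct (by omega)
    have hx' := ihx.exists_ne_zero hx
    have hy' := ihy.exists_ne_zero hy
    have hz' := ihz.exists_ne_zero hz
    simp only [← mem_axisLayer hat, ← mem_axisLayer hbt, ← mem_axisLayer hct] at hx' hy' hz'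
    rw [← ihx.sum_axisLayer hat] at hsum
    exact ⟨ihx.succ hat (hshell.x_lo_eq_zero hx' hy' hz' hsum)
        (hshell.x_hi_eq_zero hx' hy' hz' hsum),
      ihy.succ hbt (hshell.y_lo_eq_zero hx' hy' hz' hsum)
        (hshell.y_hi_eq_zero hx' hy' hz' hsum),
      ihz.succ hct (hshell.z_lo_eq_zero hx' hy' hz' hsum)
        (hshell.z_hi_eq_zero hx' hy' hz' hsum)⟩

theorem sum_ne_zero (h : TileConst n x y z) (hx : x ≠ 0) (hy : y ≠ 0) (hz : z ≠ 0) :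
    ∑ i, x i ≠ 0 := fun hsum => by
  obtain ⟨hvx, hvy, hvz⟩ := h.vanishesOutside ha hb hc hx hy hz hsum le_rfl
  obtain ⟨i, hi, hxi⟩ := hvx.exists_ne_zero hx
  obtain ⟨j, hj, hyj⟩ := hvy.exists_ne_zero hy
  obtain ⟨l, hl, hzl⟩ := hvz.exists_ne_zero hz
  have hdom {i' : Fin a} (hi' : n + 1 ≤ (i' : ℕ) ∧ (i' : ℕ) < a - (n + 1)) :
      (i', j, l) ∈ (Tile.box a b c (none : Tile n)).dom a b c := by
    simp only [Box.mem_dom, Tile.box, coreBox]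
    omega
  let core : Finset (Fin a) := {i' | n + 1 ≤ (i' : ℕ) ∧ (i' : ℕ) < a - (n + 1)}
  have hconst : ConstNeZeroOn x core := ⟨x i, hxi, fun i' hi' =>
    mul_right_cancel₀ hyj (mul_right_cancel₀ hzl
      (h none _ (hdom (Finset.mem_filter.1 hi').2) _ (hdom hi)))⟩
  refine hconst.sum_ne_zero ⟨i, by simpa [core] using hi⟩ (Eq.trans ?_ hsum)
  exact Finset.sum_subset (Finset.subset_univ _) fun i' _ hi' => hvx i' (by simpa [core] using hi')

end TileConst

theorem tileConst_of_inner_eq_zero (ha : 2 * n + 3 ≤ a) (hb : 2 * n + 3 ≤ b)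
    (hc : 2 * n + 3 ≤ c) {x : EuclideanSpace ℂ (Fin a)} {y : EuclideanSpace ℂ (Fin b)}
    {z : EuclideanSpace ℂ (Fin c)} (h : ∀ ψ ∈ setU a b c n, inner ℂ ψ (triProd x y z) = 0) :
    TileConst n x y z := fun k p hp q hq =>
  (k.valid ha hb hc).fourierOn.eq_of_coeff (g := (triProd x y z).ofLp) (fun s hs h0 => by
    rw [← inner_eq_star_dotProduct]
    exact h _ (mem_setU.2 (.inr ⟨⟨k, s⟩, mem_labels.2 ⟨h0, hs⟩, rfl⟩))) hp hq

theorem isUPB_setU (ha : 2 * n + 3 ≤ a) (hb : 2 * n + 3 ≤ b) (hc : 2 * n + 3 ≤ c) :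
    IsUPB (setU a b c n) := by
  refine ⟨isOPS_setU ha hb hc, span_setU_ne_top ha hb hc, ?_⟩
  rintro _ hψ ⟨hne, x, y, z, rfl⟩
  have horth : ∀ φ ∈ setU a b c n, inner ℂ φ (triProd x y z) = 0 := fun φ hφ =>
    (Submodule.mem_orthogonal _ _).1 hψ φ (Submodule.subset_span hφ)
  have hconst := tileConst_of_inner_eq_zero ha hb hc horth
  have hsum : (∑ i, x i) * (∑ j, y j) * ∑ l, z l = 0 := by
    rw [← horth _ (mem_setU.2 (.inl rfl)), inner_stopper]
    simp only [Fintype.sum_prod_type, triProd_apply, ← Finset.mul_sum, ← Finset.sum_mul]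
  have hx : x.ofLp ≠ 0 := fun h => hne (by ext p; simp [triProd_apply, h])
  have hy : y.ofLp ≠ 0 := fun h => hne (by ext p; simp [triProd_apply, h])
  have hz : z.ofLp ≠ 0 := fun h => hne (by ext p; simp [triProd_apply, h])
  exact mul_ne_zero (mul_ne_zero (hconst.sum_ne_zero ha hb hc hx hy hz)
    (hconst.rotate.sum_ne_zero hb hc ha hy hz hx))
    (hconst.rotate.rotate.sum_ne_zero hc ha hb hz hx hy) hsum

end Unextendible

namespace FourierOn

variable {T S : Type*} [Fintype T] [DecidableEq T] [Zero S] [DecidableEq S]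
  {D : Set T} {I : Finset S} {φ : S → T → ℂ} {N : ℕ}

theorem eq_zero_of_dotProduct (h : FourierOn D I φ N) {g : T → ℂ}
    (hg : ∀ s ∈ I, g ⬝ᵥ φ s = 0) {p : T} (hp : p ∈ D) : g p = 0 :=
  star_eq_zero.1 (h.eq_zero_of_coeff (g := star g)
    (fun s hs => by rw [Matrix.star_dotProduct_star, hg s hs, star_zero]) hp)

theorem eq_of_dotProduct (h : FourierOn D I φ N) {g : T → ℂ}
    (hg : ∀ s ∈ I, s ≠ 0 → g ⬝ᵥ φ s = 0) {p q : T} (hp : p ∈ D) (hq : q ∈ D) : g p = g q :=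
  star_injective (h.eq_of_coeff (g := star g)
    (fun s hs h0 => by rw [Matrix.star_dotProduct_star, hg s hs h0, star_zero]) hp hq)

theorem star_dotProduct_one (h : FourierOn D I φ N) {s : S} (hs : s ∈ I) :
    star (φ s) ⬝ᵥ 1 = if s = 0 then (N : ℂ) else 0 := by
  rw [← h.orth s hs 0 h.zero_mem]
  refine Finset.sum_congr rfl fun p _ => ?_
  by_cases hp : p ∈ D
  · rw [h.zero_apply p hp, Pi.one_apply]
  · simp [h.supp s p hp]

end FourierOn

theorem star_star_dotProduct_mulVec {T : Type*} [Fintype T] {E : Matrix T T ℂ}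
    (hE : E.IsHermitian) (v w : T → ℂ) : star (star v ⬝ᵥ E *ᵥ w) = star w ⬝ᵥ E *ᵥ v := by
  rw [← Matrix.star_dotProduct_star, star_star, Matrix.star_mulVec, hE.eq, Matrix.dotProduct_mulVec]

/-- The matrix `E` corrected by its row and column at `o`. When `E` is diagonal on the nonconstant
Fourier vectors of a set of `N` points and its column sums, `o` included, are constant, the
correction makes it diagonal on the constant vector too. -/
def pointCorrection {T : Type*} (E : Matrix T T ℂ) (o : T) (N : ℕ) : Matrix T T ℂ :=
  E + (N⁻¹ : ℂ) • (Matrix.vecMulVec 1 (E o) + Matrix.vecMulVec (fun p => E p o) 1)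

theorem pointCorrection_apply {T : Type*} (E : Matrix T T ℂ) (o : T) (N : ℕ) (p q : T) :
    pointCorrection E o N p q = E p q + (N : ℂ)⁻¹ * (E o q + E p o) := by
  simp [pointCorrection, mul_add]

theorem isHermitian_pointCorrection {T : Type*} {E : Matrix T T ℂ} (hE : E.IsHermitian) (o : T)
    (N : ℕ) : (pointCorrection E o N).IsHermitian := by
  ext p q
  simp only [Matrix.conjTranspose_apply, pointCorrection_apply, star_add, star_mul', hE.apply,
    star_inv₀, star_natCast]
  ring

namespace FourierOn

variable {T S : Type*} [Fintype T] [DecidableEq T] [Zero S] [DecidableEq S]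
  {D : Set T} {I : Finset S} {φ : S → T → ℂ} {N : ℕ} {E : Matrix T T ℂ} {o : T}

theorem star_dotProduct_pointCorrection (h : FourierOn D I φ N) (E : Matrix T T ℂ) (o : T)
    {s s' : S} (hs : s ∈ I) (hs' : s' ∈ I) (h0 : s' ≠ 0) :
    star (φ s) ⬝ᵥ pointCorrection E o N *ᵥ φ s' =
      star (φ s) ⬝ᵥ E *ᵥ φ s' + if s = 0 then E o ⬝ᵥ φ s' else 0 := by
  have hone : (1 : T → ℂ) ⬝ᵥ φ s' = 0 := (one_dotProduct _).trans (h.sum_eq_zero hs' h0)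
  rw [pointCorrection, Matrix.add_mulVec, Matrix.smul_mulVec, Matrix.add_mulVec,
    Matrix.vecMulVec_mulVec, Matrix.vecMulVec_mulVec, hone, dotProduct_add]
  have := h.natCast_ne_zero
  split_ifs with hs0
  · subst hs0
    simp [h.star_dotProduct_one hs, mul_comm, this]
  · simp [h.star_dotProduct_one hs, hs0]

theorem star_dotProduct_zero_add (h : FourierOn D I φ N) (ho : o ∉ D)
    (hout : ∀ p ∉ insert o D, ∀ q ∈ D, E p q = 0) {q : T} (hq : q ∈ D) :
    (star (φ 0) ᵥ* E) q + E o q = ∑ p, E p q := by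
  have hrow : (star (φ 0) ᵥ* E) q = ∑ p, star (φ 0) p * E p q := rfl
  have hsub : ∑ p, (E p q - star (φ 0) p * E p q) = E o q := by
    refine (Finset.sum_eq_single_of_mem o (Finset.mem_univ _) fun p _ hpo => ?_).trans ?_
    · by_cases hp : p ∈ D
      · simp [h.zero_apply p hp]
      · simp [hout p (by simp [hpo, hp]) q hq]
    · simp [h.supp 0 o ho]
  rw [hrow, ← hsub, Finset.sum_sub_distrib, add_sub_cancel]

theorem pointCorrection_eq_of_sameCorrelation (h : FourierOn D I φ N) (hE : E.IsHermitian)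
    (ho : o ∉ D) (hdiag : ∀ s ∈ I, ∀ s' ∈ I, s ≠ 0 → s' ≠ 0 → s ≠ s' →
      star (φ s) ⬝ᵥ E *ᵥ φ s' = 0)
    (hout : ∀ p ∉ insert o D, ∀ q ∈ D, E p q = 0)
    (hsum : ∀ q ∈ D, ∀ q' ∈ D, ∑ p, E p q = ∑ p, E p q') {p q p' q' : T}
    (hp : p ∈ D) (hq : q ∈ D) (hp' : p' ∈ D) (hq' : q' ∈ D)
    (hc : SameCorrelation I φ p q p' q') :
    pointCorrection E o N p q = pointCorrection E o N p' q' := by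
  have hright : ∀ s ∈ I, ∀ s' ∈ I, s' ≠ 0 → s ≠ s' →
      star (φ s) ⬝ᵥ pointCorrection E o N *ᵥ φ s' = 0 := fun s hs s' hs' h0' hne => by
    rw [h.star_dotProduct_pointCorrection E o hs hs' h0']
    by_cases h0 : s = 0
    · subst h0
      rw [if_pos rfl, Matrix.dotProduct_mulVec, ← add_dotProduct]
      refine h.dotProduct_eq_zero_of_const hs' h0' fun r hr r' hr' => ?_
      rw [Pi.add_apply, Pi.add_apply, h.star_dotProduct_zero_add ho hout hr,
        h.star_dotProduct_zero_add ho hout hr', hsum r hr r' hr']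
    · rw [if_neg h0, add_zero, hdiag s hs s' hs' h0 h0' hne]
  refine h.apply_eq_of_diagonal (fun s hs s' hs' hne => ?_) hp hq hp' hq' hc
  by_cases h0' : s' = 0
  · have h0 : s ≠ 0 := fun h0 => hne (h0.trans h0'.symm)
    rw [← star_star_dotProduct_mulVec (isHermitian_pointCorrection hE o N),
      hright s' hs' s hs h0 hne.symm, star_zero]
  · exact hright s hs s' hs' h0' hne

end FourierOn

/-- The lines `{p | p.2 = v}` and `{p | p.1 = u}` cut the plane into three parts: the first line,
the rest of the second, and everything else. `E` has no entries between distinct parts of `D`. -/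
structure SplitAlong {α β : Type*} (E : Matrix (α × β) (α × β) ℂ) (D : Set (α × β)) (u : α)
    (v : β) : Prop where
  snd : ∀ p ∈ D, ∀ q ∈ D, p.2 = v → q.2 ≠ v → E p q = 0
  fst : ∀ p ∈ D, ∀ q ∈ D, p.1 = u → p.2 ≠ v → q.1 ≠ u → q.2 ≠ v → E p q = 0

section Rectangle

variable {α β S S' : Type*} [Fintype α] [DecidableEq α] [Fintype β] [DecidableEq β]
  [Zero S] [DecidableEq S] [Zero S'] [DecidableEq S']
  {J : Set α} {I : Finset S} {φ : S → α → ℂ} {N : ℕ}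
  {K : Set β} {I' : Finset S'} {φ' : S' → β → ℂ} {N' : ℕ}
  {E : Matrix (α × β) (α × β) ℂ} {u u' : α} {v v' : β} {o : α × β}

theorem SplitAlong.apply_corner_eq_zero (hJ : FourierOn J I φ N) (hK : FourierOn K I' φ' N')
    (hE : E.IsHermitian) (hsplit : SplitAlong E (insert o (J ×ˢ K)) u v)
    (hu : u ∈ J) (hu' : u' ∈ J) (huu' : u' ≠ u) (hv : v ∈ K) (hou : o.1 = u) (hoK : o.2 ∉ K)
    (hinv : ∀ p ∈ J ×ˢ K, ∀ q ∈ J ×ˢ K, ∀ p' ∈ J ×ˢ K, ∀ q' ∈ J ×ˢ K,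
      SameCorrelation (I ×ˢ I') (prodFamily φ φ') p q p' q' →
      pointCorrection E o (N * N') p q = pointCorrection E o (N * N') p' q')
    {p : α × β} (hp : p ∈ J ×ˢ K) : E o p = 0 := by
  have hov : o.2 ≠ v := fun h => hoK (h ▸ hv)
  have ho := Set.mem_insert o (J ×ˢ K)
  have hcol {r : α × β} (hr : r ∈ J ×ˢ K) (hrv : r.2 = v) : E r o = 0 :=
    hsplit.snd r (.inr hr) o ho hrv hov
  by_cases hpv : p.2 = v
  · rw [← hE.apply, hcol hp hpv, star_zero]
  by_cases hpu : p.1 = u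
  · have hr : (u, v) ∈ J ×ˢ K := ⟨hu, hv⟩
    have hr' : (u', v) ∈ J ×ˢ K := ⟨hu', hv⟩
    have hp' : (u', p.2) ∈ J ×ˢ K := ⟨hu', hp.2⟩
    have hshift := hinv (u, v) hr p hp (u', v) hr' (u', p.2) hp'
      (SameCorrelation.prod (hpu ▸ hJ.sameCorrelation_diag hp.1 hu') fun _ _ => rfl)
    simp only [pointCorrection_apply] at hshift
    rw [hsplit.snd _ (.inr hr) _ (.inr hp) rfl hpv, hsplit.snd _ (.inr hr') _ (.inr hp') rfl hpv,
      hcol hr rfl, hcol hr' rfl, hsplit.fst o ho _ (.inr hp') hou hov huu' hpv, zero_add, add_zero,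
      add_zero, mul_zero, zero_add] at hshift
    exact (mul_eq_zero.1 hshift).resolve_left (inv_ne_zero (hJ.prod hK).natCast_ne_zero)
  · exact hsplit.fst o ho p (.inr hp) hou hov hpu hpv

theorem SplitAlong.apply_eq_zero_of_invariant (hJ : FourierOn J I φ N) (hK : FourierOn K I' φ' N')
    (hsplit : SplitAlong E (J ×ˢ K) u v) (hu : u ∈ J) (hv : v ∈ K) (hv' : v' ∈ K) (hvv' : v' ≠ v)
    (hinv : ∀ p ∈ J ×ˢ K, ∀ q ∈ J ×ˢ K, ∀ p' ∈ J ×ˢ K, ∀ q' ∈ J ×ˢ K,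
      SameCorrelation (I ×ˢ I') (prodFamily φ φ') p q p' q' → E p q = E p' q')
    {p q : α × β} (hp : p ∈ J ×ˢ K) (hq : q ∈ J ×ˢ K) (hpq : p ≠ q) : E p q = 0 := by
  by_cases h2 : p.2 = q.2
  · have h1 : p.1 ≠ q.1 := fun h1 => hpq (Prod.ext h1 h2)
    obtain ⟨j, hj, hc⟩ := hJ.exists_shift _ hp.1 _ hq.1 u hu
    have hju : j ≠ u := fun h =>
      h1 ((hJ.eq_iff_eq_of_sameCorrelation hp.1 hq.1 hu hj hc).2 h.symm)
    rw [hinv p hp q hq (u, v') ⟨hu, hv'⟩ (j, v') ⟨hj, hv'⟩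
      (SameCorrelation.prod hc (h2 ▸ hK.sameCorrelation_diag hp.2 hv'))]
    exact hsplit.fst _ ⟨hu, hv'⟩ _ ⟨hj, hv'⟩ rfl hvv' hju hvv'
  · obtain ⟨k, hk, hc⟩ := hK.exists_shift _ hp.2 _ hq.2 v hv
    have hkv : k ≠ v := fun h =>
      h2 ((hK.eq_iff_eq_of_sameCorrelation hp.2 hq.2 hv hk hc).2 h.symm)
    rw [hinv p hp q hq (p.1, v) ⟨hp.1, hv⟩ (q.1, k) ⟨hq.1, hk⟩
      (SameCorrelation.prod (fun _ _ => rfl) hc)]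
    exact hsplit.snd (p.1, v) ⟨hp.1, hv⟩ (q.1, k) ⟨hq.1, hk⟩ rfl hkv

/-- The point `o` absorbs the failure of `E` to be diagonal on the constant vector of the
rectangle. -/
theorem SplitAlong.apply_eq_zero (hJ : FourierOn J I φ N) (hK : FourierOn K I' φ' N')
    (hE : E.IsHermitian) (hsplit : SplitAlong E (insert o (J ×ˢ K)) u v)
    (hu : u ∈ J) (hu' : u' ∈ J) (huu' : u' ≠ u) (hv : v ∈ K) (hv' : v' ∈ K) (hvv' : v' ≠ v)
    (hou : o.1 = u) (hoK : o.2 ∉ K)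
    (hdiag : ∀ s ∈ I ×ˢ I', ∀ s' ∈ I ×ˢ I', s ≠ 0 → s' ≠ 0 → s ≠ s' →
      star (prodFamily φ φ' s) ⬝ᵥ E *ᵥ prodFamily φ φ' s' = 0)
    (hout : ∀ p ∉ insert o (J ×ˢ K), ∀ q ∈ J ×ˢ K, E p q = 0)
    (hsum : ∀ q ∈ J ×ˢ K, ∀ q' ∈ J ×ˢ K, ∑ p, E p q = ∑ p, E p q') {p q : α × β}
    (hp : p ∈ insert o (J ×ˢ K)) (hq : q ∈ insert o (J ×ˢ K)) (hpq : p ≠ q) : E p q = 0 := by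
  have hinv : ∀ p ∈ J ×ˢ K, ∀ q ∈ J ×ˢ K, ∀ p' ∈ J ×ˢ K, ∀ q' ∈ J ×ˢ K,
      SameCorrelation (I ×ˢ I') (prodFamily φ φ') p q p' q' →
      pointCorrection E o (N * N') p q = pointCorrection E o (N * N') p' q' :=
    fun p hp q hq p' hp' q' hq' => (hJ.prod hK).pointCorrection_eq_of_sameCorrelation hE
      (fun ho => hoK ho.2) hdiag hout hsum hp hq hp' hq'
  have hcorner {r : α × β} (hr : r ∈ J ×ˢ K) : E o r = 0 :=
    hsplit.apply_corner_eq_zero hJ hK hE hu hu' huu' hv hou hoK hinv hr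
  have hcorner' {r : α × β} (hr : r ∈ J ×ˢ K) : E r o = 0 := by
    rw [← hE.apply, hcorner hr, star_zero]
  have happly {r r' : α × β} (hr : r ∈ J ×ˢ K) (hr' : r' ∈ J ×ˢ K) :
      pointCorrection E o (N * N') r r' = E r r' := by
    rw [pointCorrection_apply, hcorner hr', hcorner' hr, add_zero, mul_zero, add_zero]
  have hsplit' : SplitAlong E (J ×ˢ K) u v :=
    ⟨fun p hp q hq => hsplit.snd p (.inr hp) q (.inr hq),
      fun p hp q hq => hsplit.fst p (.inr hp) q (.inr hq)⟩
  rcases hp with rfl | hp <;> rcases hq with rfl | hq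
  · exact absurd rfl hpq
  · exact hcorner hq
  · exact hcorner' hp
  · refine hsplit'.apply_eq_zero_of_invariant hJ hK hu hv hv' hvv'
      (fun r hr r' hr' t ht t' ht' hc => ?_) hp hq hpq
    rw [← happly hr hr', ← happly ht ht', hinv r hr r' hr' t ht t' ht' hc]

end Rectangle

namespace FourierOn

variable {T S T' S' : Type*} [Fintype T] [DecidableEq T] [Zero S] [DecidableEq S]
  [Fintype T'] [DecidableEq T'] [Zero S'] [DecidableEq S']
  {D : Set T} {I : Finset S} {φ : S → T → ℂ} {N : ℕ}
  {D' : Set T'} {I' : Finset S'} {φ' : S' → T' → ℂ} {N' : ℕ} {E : Matrix T T' ℂ}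

theorem apply_eq_zero (h : FourierOn D I φ N) (h' : FourierOn D' I' φ' N')
    (hE : ∀ s ∈ I, ∀ s' ∈ I', star (φ s) ⬝ᵥ E *ᵥ φ' s' = 0) {p : T} {q : T'} (hp : p ∈ D)
    (hq : q ∈ D') : E p q = 0 :=
  h.eq_zero_of_coeff (g := E.col q) (fun s hs =>
    h'.eq_zero_of_dotProduct (g := star (φ s) ᵥ* E)
      (fun s' hs' => by rw [← Matrix.dotProduct_mulVec, hE s hs s' hs']) hq) hp

theorem apply_eq_apply (h : FourierOn D I φ N) (h' : FourierOn D' I' φ' N')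
    (hE : ∀ s ∈ I, ∀ s' ∈ I', s' ≠ 0 → star (φ s) ⬝ᵥ E *ᵥ φ' s' = 0) {p : T} {q q' : T'}
    (hp : p ∈ D) (hq : q ∈ D') (hq' : q' ∈ D') : E p q = E p q' :=
  sub_eq_zero.1 <| h.eq_zero_of_coeff (g := E.col q - E.col q') (fun s hs => by
    rw [dotProduct_sub, sub_eq_zero]
    exact h'.eq_of_dotProduct (g := star (φ s) ᵥ* E)
      (fun s' hs' h0 => by rw [← Matrix.dotProduct_mulVec, hE s hs s' hs' h0]) hq hq') hp

end FourierOn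

theorem star_four_dotProduct_four_ne_zero {d x x' m m' s : ℕ} (hm : m = m') {i : Fin d}
    (hi : i ∈ ival d x m) (hi' : i ∈ ival d x' m') :
    star (four d x m s).ofLp ⬝ᵥ (four d x' m' s).ofLp ≠ 0 := by
  classical
  subst hm
  have hphase : star (four d x m s).ofLp ⬝ᵥ (four d x' m s).ofLp =
      ∑ j, if j ∈ ival d x m ∩ ival d x' m then w m ^ (s * (x - x') : ℤ) else 0 := by
    refine Finset.sum_congr rfl fun j _ => ?_
    by_cases hj : j ∈ ival d x m
    · by_cases hj' : j ∈ ival d x' m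
      · rw [if_pos ⟨hj, hj'⟩, Pi.star_apply, four_apply_of_mem hj, four_apply_of_mem hj', mul_comm,
          w_pow_mul_star_w_pow]
        congr 1
        push_cast [hj.1, hj'.1]
        ring
      · rw [if_neg fun h => hj' h.2, four_apply_of_notMem hj', mul_zero]
    · rw [if_neg fun h => hj h.1, Pi.star_apply, four_apply_of_notMem hj, star_zero, zero_mul]
  rw [hphase, ← Finset.sum_filter, Finset.sum_const, nsmul_eq_mul]
  exact mul_ne_zero (Nat.cast_ne_zero.2 (Finset.card_ne_zero_of_mem
    (Finset.mem_filter.2 ⟨Finset.mem_univ i, hi, hi'⟩))) (zpow_ne_zero _ (w_ne_zero m))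

theorem star_four_dotProduct_ket_ne_zero {d x m s : ℕ} {i : Fin d} (hi : i ∈ ival d x m) :
    star (four d x m s).ofLp ⬝ᵥ (ket d i).ofLp ≠ 0 := by
  have hket : (ket d i).ofLp = Pi.single i 1 := by
    ext j
    simp [ket_apply, Pi.single_apply, Fin.ext_iff]
  rw [hket, dotProduct_single_one, Pi.star_apply, four_apply_of_mem hi]
  exact star_ne_zero.2 (pow_ne_zero _ (w_ne_zero m))

section Bipartite

variable {X Y : Type} [Fintype X] [Fintype Y] [DecidableEq X] [DecidableEq Y]

/-- Distinct states of `U` are orthogonal with respect to the form of `K`. For `K = Lᴴ * L` this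
says that the operator `L` keeps `U` orthogonal. -/
def OrthogonalUnder (U : Set (EuclideanSpace ℂ (X × Y))) (K : Matrix (X × Y) (X × Y) ℂ) : Prop :=
  U.Pairwise fun ψ φ => inner ℂ ψ (actOn K φ) = 0

/-- `OrthogonalUnder` for an operator `E` of the second party. -/
def KeepsOrthogonalRight (U : Set (EuclideanSpace ℂ (X × Y))) (E : Matrix Y Y ℂ) : Prop :=
  OrthogonalUnder U ((1 : Matrix X X ℂ) ⊗ₖ E)

theorem inner_actOn_one_kronecker (E : Matrix Y Y ℂ) {ψ φ : EuclideanSpace ℂ (X × Y)}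
    {f f' : X → ℂ} {g g' : Y → ℂ} (hψ : ∀ p, ψ p = f p.1 * g p.2)
    (hφ : ∀ p, φ p = f' p.1 * g' p.2) :
    inner ℂ ψ (actOn ((1 : Matrix X X ℂ) ⊗ₖ E) φ) = (star f ⬝ᵥ f') * (star g ⬝ᵥ E *ᵥ g') := by
  have hact : (actOn ((1 : Matrix X X ℂ) ⊗ₖ E) φ).ofLp = fun p => f' p.1 * (E *ᵥ g') p.2 := by
    ext p
    simp [actOn, Matrix.mulVec, dotProduct, Fintype.sum_prod_type, Matrix.kroneckerMap_apply,
      Matrix.one_apply, hφ, Finset.mul_sum, mul_left_comm]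
  have hstar : star ψ.ofLp = fun p => star f p.1 * star g p.2 :=
    funext fun p => by simp [hψ]
  rw [inner_eq_star_dotProduct, hact, hstar, dotProduct_prod]

end Bipartite

namespace Box

variable {a b c : ℕ} {B : Box}

/-- The projection of the box to the last two coordinates. -/
def plane (B : Box) (b c : ℕ) : Set (Fin b × Fin c) := ival b B.y B.q ×ˢ ival c B.z B.r

/-- The frequencies of the Fourier vectors of the projected box. -/
def planeFreq (B : Box) : Finset (ℕ × ℕ) := Finset.range B.q ×ˢ Finset.range B.r

/-- The Fourier vectors of the projected box. -/
def planeVec (B : Box) (b c : ℕ) : ℕ × ℕ → Fin b × Fin c → ℂ :=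
  prodFamily (fun s => (four b B.y B.q s).ofLp) fun s => (four c B.z B.r s).ofLp

theorem Valid.fourierOn_plane (h : B.Valid a b c) :
    FourierOn (B.plane b c) B.planeFreq (B.planeVec b c) (B.q * B.r) :=
  (fourierOn_four h.q_ne_zero h.y_add_le).prod (fourierOn_four h.r_ne_zero h.z_add_le)

theorem vec_apply (B : Box) (s : ℕ × ℕ × ℕ) (p : Fin a × Fin b × Fin c) :
    B.vec a b c s p = four a B.x B.p s.1 p.1 * B.planeVec b c s.2 p.2 := mul_assoc ..

end Box

theorem mk_mem_labels {a b c n : ℕ} {k : Tile n} {i : ℕ} {s : ℕ × ℕ} (hi : i < (k.box a b c).p)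
    (hs : s ∈ (k.box a b c).planeFreq) (h0 : (i, s) ≠ 0) :
    (⟨k, i, s⟩ : Label n) ∈ labels a b c n :=
  mem_labels.2 ⟨h0, Finset.mem_product.2 ⟨Finset.mem_range.2 hi, hs⟩⟩

namespace KeepsOrthogonalRight

variable {a b c n : ℕ} {E : Matrix (Fin b × Fin c) (Fin b × Fin c) ℂ}

section Tiles

variable (ha : 2 * n + 3 ≤ a) (hb : 2 * n + 3 ≤ b) (hc : 2 * n + 3 ≤ c)
include ha hb hc

theorem planeVec_label (hE : KeepsOrthogonalRight (setU a b c n) E) {l l' : Label n}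
    (hl : l ∈ labels a b c n) (hl' : l' ∈ labels a b c n) (hne : l ≠ l')
    (hover : star (four a (l.1.box a b c).x (l.1.box a b c).p l.2.1).ofLp ⬝ᵥ
      (four a (l'.1.box a b c).x (l'.1.box a b c).p l'.2.1).ofLp ≠ 0) :
    star ((l.1.box a b c).planeVec b c l.2.2) ⬝ᵥ
      E *ᵥ (l'.1.box a b c).planeVec b c l'.2.2 = 0 := by
  have horth := hE (mem_setU.2 (.inr ⟨l, hl, rfl⟩)) (mem_setU.2 (.inr ⟨l', hl', rfl⟩))
    ((injOn_label_vec ha hb hc).ne hl hl' hne)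
  exact (mul_eq_zero.1 ((inner_actOn_one_kronecker E (Box.vec_apply _ _)
    (Box.vec_apply _ _)).symm.trans horth)).resolve_left hover

theorem planeVec_stopper (hE : KeepsOrthogonalRight (setU a b c n) E) (k : Tile n) {s : ℕ × ℕ}
    (hs : s ∈ (k.box a b c).planeFreq) (h0 : s ≠ 0) :
    1 ⬝ᵥ E *ᵥ (k.box a b c).planeVec b c s = 0 := by
  have hk := k.valid ha hb hc
  have hl : (⟨k, 0, s⟩ : Label n) ∈ labels a b c n :=
    mk_mem_labels hk.p_ne_zero.bot_lt hs (by simpa using h0)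
  have horth := hE (mem_setU.2 (.inl rfl)) (mem_setU.2 (.inr ⟨_, hl, rfl⟩))
    fun h => stopper_notMem_image ha hb hc ⟨_, hl, h.symm⟩
  have hx := fourierOn_four hk.p_ne_zero hk.x_add_le
  have horth := (inner_actOn_one_kronecker E (f := 1) (g := 1) (fun p => by simp [stopper_apply])
    (Box.vec_apply _ _)).symm.trans horth
  rw [star_one, star_one, one_dotProduct, hx.sum_zero] at horth
  exact (mul_eq_zero.1 horth).resolve_left hx.natCast_ne_zero

theorem sum_apply_eq (hE : KeepsOrthogonalRight (setU a b c n) E) (k : Tile n)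
    {q q' : Fin b × Fin c} (hq : q ∈ (k.box a b c).plane b c)
    (hq' : q' ∈ (k.box a b c).plane b c) : ∑ p, E p q = ∑ p, E p q' := by
  have := (k.valid ha hb hc).fourierOn_plane.eq_of_dotProduct (g := 1 ᵥ* E)
    (fun s hs h0 => by rw [← Matrix.dotProduct_mulVec, hE.planeVec_stopper ha hb hc k hs h0]) hq hq'
  simpa [Matrix.vecMul, dotProduct] using this

theorem planeVec_planeVec (hE : KeepsOrthogonalRight (setU a b c n) E) (k : Tile n) {s s' : ℕ × ℕ}
    (hs : s ∈ (k.box a b c).planeFreq) (hs' : s' ∈ (k.box a b c).planeFreq)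
    (h0 : s ≠ 0) (h0' : s' ≠ 0) (hne : s ≠ s') :
    star ((k.box a b c).planeVec b c s) ⬝ᵥ E *ᵥ (k.box a b c).planeVec b c s' = 0 := by
  have hk := k.valid ha hb hc
  have hx := fourierOn_four hk.p_ne_zero hk.x_add_le
  have hself := hx.orth 0 hx.zero_mem 0 hx.zero_mem
  rw [if_pos rfl] at hself
  exact hE.planeVec_label ha hb hc (l := ⟨k, 0, s⟩) (l' := ⟨k, 0, s'⟩)
    (mk_mem_labels hk.p_ne_zero.bot_lt hs (by simpa using h0))
    (mk_mem_labels hk.p_ne_zero.bot_lt hs' (by simpa using h0'))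
    (by simpa using hne) (hself.trans_ne hx.natCast_ne_zero)

theorem apply_eq_zero_of_ne (hE : KeepsOrthogonalRight (setU a b c n) E) {k k' : Tile n}
    (hkk : k ≠ k') (hp1 : 1 < (k.box a b c).p) (hp1' : 1 < (k'.box a b c).p)
    (hover : star (four a (k.box a b c).x (k.box a b c).p 1).ofLp ⬝ᵥ
      (four a (k'.box a b c).x (k'.box a b c).p 1).ofLp ≠ 0)
    {p q : Fin b × Fin c} (hp : p ∈ (k.box a b c).plane b c)
    (hq : q ∈ (k'.box a b c).plane b c) : E p q = 0 := by
  refine (k.valid ha hb hc).fourierOn_plane.apply_eq_zero (k'.valid ha hb hc).fourierOn_plane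
    (fun s hs s' hs' => ?_) hp hq
  exact hE.planeVec_label ha hb hc (l := ⟨k, 1, s⟩) (l' := ⟨k', 1, s'⟩)
    (mk_mem_labels hp1 hs (by simp))
    (mk_mem_labels hp1' hs' (by simp))
    (fun h => hkk (congrArg Sigma.fst h)) hover

theorem apply_eq_apply_of_ne (hE : KeepsOrthogonalRight (setU a b c n) E) {k k' : Tile n}
    (hkk : k ≠ k') (hp1 : 1 < (k.box a b c).p)
    (hover : star (four a (k.box a b c).x (k.box a b c).p 1).ofLp ⬝ᵥ
      (four a (k'.box a b c).x (k'.box a b c).p 0).ofLp ≠ 0)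
    {p q q' : Fin b × Fin c} (hp : p ∈ (k.box a b c).plane b c)
    (hq : q ∈ (k'.box a b c).plane b c) (hq' : q' ∈ (k'.box a b c).plane b c) :
    E p q = E p q' := by
  have hk' := k'.valid ha hb hc
  refine (k.valid ha hb hc).fourierOn_plane.apply_eq_apply hk'.fourierOn_plane
    (fun s hs s' hs' h0 => ?_) hp hq hq'
  exact hE.planeVec_label ha hb hc (l := ⟨k, 1, s⟩) (l' := ⟨k', 0, s'⟩)
    (mk_mem_labels hp1 hs (by simp))
    (mk_mem_labels hk'.p_ne_zero.bot_lt hs' (by simpa using h0))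
    (fun h => hkk (congrArg Sigma.fst h)) hover

end Tiles

end KeepsOrthogonalRight

/-- The projections to `[0, b) × [0, c)` of the tiles of the outermost shell. -/
def ShellTile.face (b c : ℕ) : ShellTile → Set (Fin b × Fin c)
  | A1 => {p | (p.1 : ℕ) = 0 ∧ (p.2 : ℕ) ≠ c - 1}
  | A2 => {p | (p.1 : ℕ) ≠ b - 1 ∧ (p.2 : ℕ) = c - 1}
  | A3 => {p | (p.1 : ℕ) ≠ 0 ∧ (p.2 : ℕ) ≠ c - 1}
  | B1 => {p | (p.1 : ℕ) = b - 1 ∧ (p.2 : ℕ) ≠ 0}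
  | B2 => {p | (p.1 : ℕ) ≠ 0 ∧ (p.2 : ℕ) = 0}
  | B3 => {p | (p.1 : ℕ) ≠ b - 1 ∧ (p.2 : ℕ) ≠ 0}

/-- The tile extends over all but one of the values of the first coordinate. -/
abbrev ShellTile.IsLong (e : ShellTile) : Prop := e ≠ A3 ∧ e ≠ B3

section Outermost

variable {a b c : ℕ}

theorem ShellTile.plane_box_zero (hb : 3 ≤ b) (hc : 3 ≤ c) (e : ShellTile) :
    (e.box a b c 0).plane b c = e.face b c := by
  ext p
  cases e <;>
    simp only [Box.plane, box, face, Set.mem_prod, mem_ival, Set.mem_ofPred_eq] <;> omega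

theorem ShellTile.IsLong.p_box_zero {e : ShellTile} (he : e.IsLong) :
    (e.box a b c 0).p = a - 1 := by
  cases e <;> first | rfl | exact absurd he (by decide)

theorem ShellTile.IsLong.one_mem_ival {e : ShellTile} (he : e.IsLong) (ha : 3 ≤ a) :
    (⟨1, by omega⟩ : Fin a) ∈ ival a (e.box a b c 0).x (e.box a b c 0).p := by
  rw [he.p_box_zero]
  cases e <;> simp only [box, mem_ival] <;> first | omega | exact absurd he (by decide)

end Outermost

namespace KeepsOrthogonalRight

variable {a b c n : ℕ} {E : Matrix (Fin b × Fin c) (Fin b × Fin c) ℂ}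
  (ha : 2 * n + 3 ≤ a) (hb : 2 * n + 3 ≤ b) (hc : 2 * n + 3 ≤ c)
include ha hb hc

theorem apply_eq_zero_of_isLong (hE : KeepsOrthogonalRight (setU a b c n) E) {e e' : ShellTile}
    (he : e.IsLong) (he' : e'.IsLong) (hne : e ≠ e') {p q : Fin b × Fin c} (hp : p ∈ e.face b c)
    (hq : q ∈ e'.face b c) : E p q = 0 := by
  rw [← ShellTile.plane_box_zero (a := a) (by omega) (by omega)] at hp hq
  have hpos : 1 < a - 1 := by omega
  exact hE.apply_eq_zero_of_ne ha hb hc (k := some (0, e)) (k' := some (0, e')) (by simpa using hne)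
    (hpos.trans_eq he.p_box_zero.symm) (hpos.trans_eq he'.p_box_zero.symm)
    (star_four_dotProduct_four_ne_zero (he.p_box_zero.trans he'.p_box_zero.symm)
      (he.one_mem_ival (by omega)) (he'.one_mem_ival (by omega))) hp hq

theorem apply_eq_apply_of_isLong (hE : KeepsOrthogonalRight (setU a b c n) E) {e f : ShellTile}
    (he : e.IsLong) (hne : e ≠ f) {i : Fin a}
    (hi : i ∈ ival a (e.box a b c 0).x (e.box a b c 0).p)
    (hf : four a (f.box a b c 0).x (f.box a b c 0).p 0 = ket a i) {p q q' : Fin b × Fin c}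
    (hp : p ∈ e.face b c) (hq : q ∈ f.face b c) (hq' : q' ∈ f.face b c) : E p q = E p q' := by
  rw [← ShellTile.plane_box_zero (a := a) (by omega) (by omega)] at hp hq hq'
  have hover : star (four a (e.box a b c 0).x (e.box a b c 0).p 1).ofLp ⬝ᵥ
      (four a (f.box a b c 0).x (f.box a b c 0).p 0).ofLp ≠ 0 := by
    rw [hf]
    exact star_four_dotProduct_ket_ne_zero hi
  have hpos : 1 < a - 1 := by omega
  exact hE.apply_eq_apply_of_ne ha hb hc (k := some (0, e)) (k' := some (0, f))
    (by simpa using hne) (hpos.trans_eq he.p_box_zero.symm) hover hp hq hq'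

theorem apply_eq_zero_of_meets (hE : KeepsOrthogonalRight (setU a b c n) E) {e f g : ShellTile}
    (he : e.IsLong) (hg : g.IsLong) (hef : e ≠ f) (heg : e ≠ g) {i : Fin a}
    (hi : i ∈ ival a (e.box a b c 0).x (e.box a b c 0).p)
    (hf : four a (f.box a b c 0).x (f.box a b c 0).p 0 = ket a i) {r : Fin b × Fin c}
    (hrf : r ∈ f.face b c) (hrg : r ∈ g.face b c) {p q : Fin b × Fin c}
    (hp : p ∈ e.face b c) (hq : q ∈ f.face b c) : E p q = 0 :=
  (hE.apply_eq_apply_of_isLong ha hb hc he hef hi hf hp hq hrf).trans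
    (hE.apply_eq_zero_of_isLong ha hb hc he hg heg hp hrg)

theorem apply_eq_zero_of_mem_A3 (hE : KeepsOrthogonalRight (setU a b c n) E) {e : ShellTile}
    (he : e = .A1 ∨ e = .A2) {p q : Fin b × Fin c} (hp : p ∈ e.face b c)
    (hq : q ∈ ShellTile.A3.face b c) : E p q = 0 := by
  have hr : ((⟨b - 1, by omega⟩, ⟨0, by omega⟩) : Fin b × Fin c) ∈
      ShellTile.A3.face b c ∩ ShellTile.B2.face b c := by
    simp [ShellTile.face]
    omega
  have hket : four a (ShellTile.A3.box a b c 0).x (ShellTile.A3.box a b c 0).p 0 =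
      ket a (⟨a - 1, by omega⟩ : Fin a) := by
    simp [ShellTile.box, ket_eq_four]
  refine hE.apply_eq_zero_of_meets ha hb hc ?_ (by decide) ?_ ?_ ?_ hket hr.1 hr.2 hp hq <;>
    rcases he with rfl | rfl
  any_goals decide
  all_goals simp only [ShellTile.box, mem_ival]; omega

theorem apply_eq_zero_of_mem_B3 (hE : KeepsOrthogonalRight (setU a b c n) E) {e : ShellTile}
    (he : e = .B1 ∨ e = .B2) {p q : Fin b × Fin c} (hp : p ∈ e.face b c)
    (hq : q ∈ ShellTile.B3.face b c) : E p q = 0 := by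
  have hr : ((⟨0, by omega⟩, ⟨c - 1, by omega⟩) : Fin b × Fin c) ∈
      ShellTile.B3.face b c ∩ ShellTile.A2.face b c := by
    simp [ShellTile.face]
    omega
  have hket : four a (ShellTile.B3.box a b c 0).x (ShellTile.B3.box a b c 0).p 0 =
      ket a (⟨0, by omega⟩ : Fin a) := by
    simp [ShellTile.box, ket_eq_four]
  refine hE.apply_eq_zero_of_meets ha hb hc ?_ (by decide) ?_ ?_ ?_ hket hr.1 hr.2 hp hq <;>
    rcases he with rfl | rfl
  any_goals decide
  all_goals simp only [ShellTile.box, mem_ival]; omega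

end KeepsOrthogonalRight

section Cover

variable {b c : ℕ} (hb : 3 ≤ b) (hc : 3 ≤ c) {p : Fin b × Fin c}

theorem ShellTile.mem_face_of_notMem_insert_A3
    (hp : p ∉ insert (⟨b - 1, by omega⟩, ⟨c - 1, by omega⟩) (A3.face b c)) :
    ∃ e, (e = A1 ∨ e = A2) ∧ p ∈ e.face b c := by
  simp only [Set.mem_insert_iff, face, Set.mem_ofPred_eq, Prod.ext_iff, Fin.ext_iff] at hp
  by_cases h : (p.2 : ℕ) = c - 1
  · exact ⟨A2, .inr rfl, show _ ∧ _ by omega⟩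
  · exact ⟨A1, .inl rfl, show _ ∧ _ by omega⟩

theorem ShellTile.mem_face_of_notMem_insert_B3
    (hp : p ∉ insert (⟨0, by omega⟩, ⟨0, by omega⟩) (B3.face b c)) :
    ∃ e, (e = B1 ∨ e = B2) ∧ p ∈ e.face b c := by
  simp only [Set.mem_insert_iff, face, Set.mem_ofPred_eq, Prod.ext_iff, Fin.ext_iff] at hp
  by_cases h : (p.2 : ℕ) = 0
  · exact ⟨B2, .inr rfl, show _ ∧ _ by omega⟩
  · exact ⟨B1, .inl rfl, show _ ∧ _ by omega⟩

theorem ShellTile.mem_insert_A3_or_mem_insert_B3 (p : Fin b × Fin c) :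
    p ∈ insert (⟨b - 1, by omega⟩, ⟨c - 1, by omega⟩) (A3.face b c) ∨
      p ∈ insert (⟨0, by omega⟩, ⟨0, by omega⟩) (B3.face b c) := by
  simp only [Set.mem_insert_iff, face, Set.mem_ofPred_eq, Prod.ext_iff, Fin.ext_iff]
  omega

end Cover

namespace KeepsOrthogonalRight

variable {a b c n : ℕ} {E : Matrix (Fin b × Fin c) (Fin b × Fin c) ℂ}
  (ha : 2 * n + 3 ≤ a) (hb : 2 * n + 3 ≤ b) (hc : 2 * n + 3 ≤ c)
include ha hb hc

theorem sum_apply_eq_of_mem_face (hE : KeepsOrthogonalRight (setU a b c n) E) (e : ShellTile)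
    {q q' : Fin b × Fin c} (hq : q ∈ e.face b c) (hq' : q' ∈ e.face b c) :
    ∑ p, E p q = ∑ p, E p q' := by
  rw [← ShellTile.plane_box_zero (a := a) (by omega) (by omega)] at hq hq'
  exact hE.sum_apply_eq ha hb hc (some (0, e)) hq hq'

theorem sum_apply_eq_sum_apply (hE : KeepsOrthogonalRight (setU a b c n) E)
    (q q' : Fin b × Fin c) : ∑ p, E p q = ∑ p, E p q' := by
  suffices h : ∀ q : Fin b × Fin c, ∑ p, E p q = ∑ p, E p (⟨1, by omega⟩, ⟨1, by omega⟩) from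
    (h q).trans (h q').symm
  have hinner {q : Fin b × Fin c} (hq : q ∈ ShellTile.A3.face b c ∪ ShellTile.B3.face b c) :
      ∑ p, E p q = ∑ p, E p (⟨1, by omega⟩, ⟨1, by omega⟩) := by
    rcases hq with hq | hq <;> refine hE.sum_apply_eq_of_mem_face ha hb hc _ hq ?_ <;>
      simp only [ShellTile.face, Set.mem_ofPred_eq] <;> omega
  intro q
  by_cases hq : q ∈ ShellTile.A3.face b c ∪ ShellTile.B3.face b c
  · exact hinner hq
  simp only [ShellTile.face, Set.mem_union, Set.mem_ofPred_eq] at hq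
  by_cases h : (q.1 : ℕ) = 0
  · have hq' : ((q.1, ⟨1, by omega⟩) : Fin b × Fin c) ∈ ShellTile.B3.face b c := by
      simp only [ShellTile.face, Set.mem_ofPred_eq]; omega
    refine (hE.sum_apply_eq_of_mem_face ha hb hc .A1 ?_ ?_).trans (hinner (.inr hq')) <;>
      simp only [ShellTile.face, Set.mem_ofPred_eq] <;> omega
  · have hq' : ((q.1, ⟨1, by omega⟩) : Fin b × Fin c) ∈ ShellTile.A3.face b c := by
      simp only [ShellTile.face, Set.mem_ofPred_eq]; omega
    refine (hE.sum_apply_eq_of_mem_face ha hb hc .B1 ?_ ?_).trans (hinner (.inl hq')) <;>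
      simp only [ShellTile.face, Set.mem_ofPred_eq] <;> omega

theorem splitAlong_A3 (hE : KeepsOrthogonalRight (setU a b c n) E) :
    SplitAlong E (insert (⟨b - 1, by omega⟩, ⟨c - 1, by omega⟩) (ShellTile.A3.face b c))
      ⟨b - 1, by omega⟩ ⟨0, by omega⟩ := by
  constructor <;> intro p hp q hq <;>
    simp only [Set.mem_insert_iff, ShellTile.face, Set.mem_ofPred_eq, Prod.ext_iff,
      Fin.ext_iff, ne_eq] at hp hq ⊢
  · intro hpv hqv
    have hpB : p ∈ ShellTile.B2.face b c := show _ ∧ _ by omega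
    by_cases hqu : (q.1 : ℕ) = b - 1
    · exact hE.apply_eq_zero_of_isLong ha hb hc (by decide) (by decide)
        (by decide : ShellTile.B2 ≠ .B1) hpB ⟨hqu, hqv⟩
    · exact hE.apply_eq_zero_of_mem_B3 ha hb hc (.inr rfl) hpB ⟨hqu, hqv⟩
  · intro hpu hpv hqu hqv
    exact hE.apply_eq_zero_of_mem_B3 ha hb hc (.inl rfl) ⟨hpu, hpv⟩ ⟨hqu, hqv⟩

theorem splitAlong_B3 (hE : KeepsOrthogonalRight (setU a b c n) E) :
    SplitAlong E (insert (⟨0, by omega⟩, ⟨0, by omega⟩) (ShellTile.B3.face b c))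
      ⟨0, by omega⟩ ⟨c - 1, by omega⟩ := by
  constructor <;> intro p hp q hq <;>
    simp only [Set.mem_insert_iff, ShellTile.face, Set.mem_ofPred_eq, Prod.ext_iff,
      Fin.ext_iff, ne_eq] at hp hq ⊢
  · intro hpv hqv
    have hpA : p ∈ ShellTile.A2.face b c := show _ ∧ _ by omega
    by_cases hqu : (q.1 : ℕ) = 0
    · exact hE.apply_eq_zero_of_isLong ha hb hc (by decide) (by decide)
        (by decide : ShellTile.A2 ≠ .A1) hpA ⟨hqu, hqv⟩
    · exact hE.apply_eq_zero_of_mem_A3 ha hb hc (.inr rfl) hpA ⟨hqu, hqv⟩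
  · intro hpu hpv hqu hqv
    exact hE.apply_eq_zero_of_mem_A3 ha hb hc (.inl rfl) ⟨hpu, hpv⟩ ⟨hqu, hqv⟩

theorem apply_eq_zero_of_mem_insert_A3 (hE : KeepsOrthogonalRight (setU a b c n) E)
    (hH : E.IsHermitian) {p q : Fin b × Fin c}
    (hp : p ∈ insert (⟨b - 1, by omega⟩, ⟨c - 1, by omega⟩) (ShellTile.A3.face b c))
    (hq : q ∈ insert (⟨b - 1, by omega⟩, ⟨c - 1, by omega⟩) (ShellTile.A3.face b c))
    (hpq : p ≠ q) : E p q = 0 := by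
  have hsplit := hE.splitAlong_A3 ha hb hc
  have hout : ∀ p ∉ insert (⟨b - 1, by omega⟩, ⟨c - 1, by omega⟩) (ShellTile.A3.face b c),
      ∀ q ∈ ShellTile.A3.face b c, E p q = 0 := fun p hp q hq => by
    obtain ⟨e, he, hpe⟩ := ShellTile.mem_face_of_notMem_insert_A3 (by omega) (by omega) hp
    exact hE.apply_eq_zero_of_mem_A3 ha hb hc he hpe hq
  rw [← ShellTile.plane_box_zero (a := a) (by omega) (by omega)] at hp hq hsplit hout
  have hvalid := Tile.valid ha hb hc (some (0, .A3))
  refine hsplit.apply_eq_zero (fourierOn_four hvalid.q_ne_zero hvalid.y_add_le)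
    (fourierOn_four hvalid.r_ne_zero hvalid.z_add_le) hH (u' := ⟨1, by omega⟩) ?_ ?_ ?_
    (v' := ⟨1, by omega⟩) ?_ ?_ ?_ rfl ?_
    (fun s hs s' hs' => hE.planeVec_planeVec ha hb hc (some (0, .A3)) hs hs') hout
    (fun q _ q' _ => hE.sum_apply_eq_sum_apply ha hb hc q q') hp hq hpq
  all_goals simp only [Tile.box, ShellTile.box, mem_ival, Fin.val_zero, ne_eq, Fin.mk.injEq]; omega

theorem apply_eq_zero_of_mem_insert_B3 (hE : KeepsOrthogonalRight (setU a b c n) E)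
    (hH : E.IsHermitian) {p q : Fin b × Fin c}
    (hp : p ∈ insert (⟨0, by omega⟩, ⟨0, by omega⟩) (ShellTile.B3.face b c))
    (hq : q ∈ insert (⟨0, by omega⟩, ⟨0, by omega⟩) (ShellTile.B3.face b c))
    (hpq : p ≠ q) : E p q = 0 := by
  have hsplit := hE.splitAlong_B3 ha hb hc
  have hout : ∀ p ∉ insert (⟨0, by omega⟩, ⟨0, by omega⟩) (ShellTile.B3.face b c),
      ∀ q ∈ ShellTile.B3.face b c, E p q = 0 := fun p hp q hq => by
    obtain ⟨e, he, hpe⟩ := ShellTile.mem_face_of_notMem_insert_B3 (by omega) (by omega) hp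
    exact hE.apply_eq_zero_of_mem_B3 ha hb hc he hpe hq
  rw [← ShellTile.plane_box_zero (a := a) (by omega) (by omega)] at hp hq hsplit hout
  have hvalid := Tile.valid ha hb hc (some (0, .B3))
  refine hsplit.apply_eq_zero (fourierOn_four hvalid.q_ne_zero hvalid.y_add_le)
    (fourierOn_four hvalid.r_ne_zero hvalid.z_add_le) hH (u' := ⟨1, by omega⟩) ?_ ?_ ?_
    (v' := ⟨1, by omega⟩) ?_ ?_ ?_ rfl ?_
    (fun s hs s' hs' => hE.planeVec_planeVec ha hb hc (some (0, .B3)) hs hs') hout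
    (fun q _ q' _ => hE.sum_apply_eq_sum_apply ha hb hc q q') hp hq hpq
  all_goals simp only [Tile.box, ShellTile.box, mem_ival, Fin.val_zero, ne_eq, Fin.mk.injEq]; omega

theorem apply_eq_zero (hE : KeepsOrthogonalRight (setU a b c n) E) (hH : E.IsHermitian)
    {p q : Fin b × Fin c} (hpq : p ≠ q) : E p q = 0 := by
  have hcover := ShellTile.mem_insert_A3_or_mem_insert_B3 (b := b) (c := c) (by omega) (by omega)
  have hmixed {p q : Fin b × Fin c}
      (hp : p ∉ insert (⟨b - 1, by omega⟩, ⟨c - 1, by omega⟩) (ShellTile.A3.face b c))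
      (hq : q ∉ insert (⟨0, by omega⟩, ⟨0, by omega⟩) (ShellTile.B3.face b c)) : E p q = 0 := by
    obtain ⟨e, he, hpe⟩ := ShellTile.mem_face_of_notMem_insert_A3 (by omega) (by omega) hp
    obtain ⟨f, hf, hqf⟩ := ShellTile.mem_face_of_notMem_insert_B3 (by omega) (by omega) hq
    refine hE.apply_eq_zero_of_isLong ha hb hc ?_ ?_ ?_ hpe hqf <;>
      rcases he with rfl | rfl <;> rcases hf with rfl | rfl <;> decide
  by_cases hpA : p ∈ insert (⟨b - 1, by omega⟩, ⟨c - 1, by omega⟩) (ShellTile.A3.face b c)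
  · by_cases hqA : q ∈ insert (⟨b - 1, by omega⟩, ⟨c - 1, by omega⟩) (ShellTile.A3.face b c)
    · exact hE.apply_eq_zero_of_mem_insert_A3 ha hb hc hH hpA hqA hpq
    by_cases hpB : p ∈ insert (⟨0, by omega⟩, ⟨0, by omega⟩) (ShellTile.B3.face b c)
    · exact hE.apply_eq_zero_of_mem_insert_B3 ha hb hc hH hpB ((hcover q).resolve_left hqA) hpq
    · rw [← hH.apply, hmixed hqA hpB, star_zero]
  · by_cases hqB : q ∈ insert (⟨0, by omega⟩, ⟨0, by omega⟩) (ShellTile.B3.face b c)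
    · exact hE.apply_eq_zero_of_mem_insert_B3 ha hb hc hH ((hcover p).resolve_left hpA) hqB hpq
    · exact hmixed hpA hqB

end KeepsOrthogonalRight

/-- Every Hermitian matrix of the second party that keeps `U` orthogonal is scalar. -/
def TrivialOnRight {X Y : Type} [Fintype X] [Fintype Y] [DecidableEq X] [DecidableEq Y]
    (U : Set (EuclideanSpace ℂ (X × Y))) : Prop :=
  ∀ E : Matrix Y Y ℂ, E.IsHermitian → KeepsOrthogonalRight U E → ∃ κ : ℂ, E = κ • 1

theorem trivialOnRight_setU {a b c n : ℕ} (ha : 2 * n + 3 ≤ a) (hb : 2 * n + 3 ≤ b)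
    (hc : 2 * n + 3 ≤ c) : TrivialOnRight (setU a b c n) := fun E hH hE => by
  let r : Fin b × Fin c := (⟨0, by omega⟩, ⟨0, by omega⟩)
  refine ⟨∑ p, E p r, ?_⟩
  ext p q
  rw [Matrix.smul_apply, Matrix.one_apply, smul_eq_mul]
  split_ifs with hpq
  · rw [mul_one, hpq, hE.sum_apply_eq_sum_apply ha hb hc r q]
    exact (Finset.sum_eq_single q (fun p _ hp => hE.apply_eq_zero ha hb hc hH hp)
      fun h => absurd (Finset.mem_univ q) h).symm
  · rw [mul_zero, hE.apply_eq_zero ha hb hc hH hpq]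

section Bipartite

variable {X Y X' Y' : Type} [Fintype X] [Fintype Y] [DecidableEq X] [DecidableEq Y]
  [Fintype X'] [Fintype Y'] [DecidableEq X'] [DecidableEq Y']
  {U : Set (EuclideanSpace ℂ (X × Y))} {P : Matrix X X ℂ} {Q : Matrix Y Y ℂ}
  {K : Matrix (X × Y) (X × Y) ℂ}

theorem inner_actOn_actOn (K : Matrix (X × Y) (X × Y) ℂ) (ψ φ : EuclideanSpace ℂ (X × Y)) :
    inner ℂ (actOn K ψ) (actOn K φ) = inner ℂ ψ (actOn (Kᴴ * K) φ) := by
  rw [actOn, ← LinearMap.adjoint_inner_right, ← Matrix.toEuclideanLin_conjTranspose_eq_adjoint]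
  simp [actOn, Matrix.toLpLin_apply]

theorem inner_actOn_smul (κ : ℂ) (K : Matrix (X × Y) (X × Y) ℂ) (ψ φ : EuclideanSpace ℂ (X × Y)) :
    inner ℂ ψ (actOn (κ • K) φ) = κ * inner ℂ ψ (actOn K φ) := by
  simp [actOn]

theorem OrthogonalUnder.of_smul {κ : ℂ} (hκ : κ ≠ 0) (h : OrthogonalUnder U (κ • K)) :
    OrthogonalUnder U K :=
  h.imp fun {ψ φ} hψφ => by
    rw [inner_actOn_smul] at hψφ
    exact (mul_eq_zero.1 hψφ).resolve_left hκ

theorem KeepsOrthogonal.orthogonalUnder (h : KeepsOrthogonal U K) : OrthogonalUnder U (Kᴴ * K) :=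
  h.imp fun {ψ φ} hψφ => (inner_actOn_actOn K ψ φ).symm.trans hψφ

/-- Every Hermitian operator of the first party under which `U` is orthogonal is scalar. -/
def TrivialOnLeft (U : Set (EuclideanSpace ℂ (X × Y))) : Prop :=
  ∀ E : Matrix X X ℂ, E.IsHermitian → OrthogonalUnder U (E ⊗ₖ (1 : Matrix Y Y ℂ)) →
    ∃ κ : ℂ, E = κ • 1

/-- A scalar multiple of an isometry. -/
def IsScaledIsometry (P : Matrix X X ℂ) : Prop := ∃ κ : ℂ, Pᴴ * P = κ • 1

theorem isScaledIsometry_one : IsScaledIsometry (1 : Matrix X X ℂ) := ⟨1, by simp⟩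

theorem IsScaledIsometry.kronecker (hP : IsScaledIsometry P) (hQ : IsScaledIsometry Q) :
    IsScaledIsometry (P ⊗ₖ Q) := by
  obtain ⟨κ, hκ⟩ := hP
  obtain ⟨μ, hμ⟩ := hQ
  refine ⟨κ * μ, ?_⟩
  rw [Matrix.conjTranspose_kronecker, ← Matrix.mul_kronecker_mul, hκ, hμ, Matrix.smul_kronecker,
    Matrix.kronecker_smul, Matrix.one_kronecker_one, smul_smul]

theorem IsScaledIsometry.actOn_ne_zero (hK : IsScaledIsometry K) {φ ψ : EuclideanSpace ℂ (X × Y)}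
    (hφ : actOn K φ ≠ 0) (hψ : ψ ≠ 0) : actOn K ψ ≠ 0 := by
  obtain ⟨κ, hκ⟩ := hK
  have hnorm (χ : EuclideanSpace ℂ (X × Y)) :
      inner ℂ (actOn K χ) (actOn K χ) = κ * inner ℂ χ χ := by
    rw [inner_actOn_actOn, hκ, inner_actOn_smul]
    simp [actOn]
  have hκ0 : κ ≠ 0 := fun h => hφ (inner_self_eq_zero.1 ((hnorm φ).trans (by rw [h, zero_mul])))
  rw [← inner_self_ne_zero (𝕜 := ℂ), hnorm]
  exact mul_ne_zero hκ0 (inner_self_ne_zero.2 hψ)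

open scoped ComplexOrder in
theorem ne_zero_of_conjTranspose_mul_self_eq_smul_one {κ : ℂ} (hκ : Pᴴ * P = κ • 1) (hP : P ≠ 0) :
    κ ≠ 0 := by
  rintro rfl
  exact hP (Matrix.conjTranspose_mul_self_eq_zero.1 (hκ.trans (zero_smul ℂ _)))

theorem TrivialOnRight.isScaledIsometry (hU : TrivialOnRight U) (hP : IsScaledIsometry P)
    (hP0 : P ≠ 0) (h : KeepsOrthogonal U (P ⊗ₖ Q)) : IsScaledIsometry Q := by
  obtain ⟨κ, hκ⟩ := hP
  refine hU _ (Matrix.isHermitian_conjTranspose_mul_self Q)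
    (OrthogonalUnder.of_smul (ne_zero_of_conjTranspose_mul_self_eq_smul_one hκ hP0) ?_)
  rw [← Matrix.smul_kronecker, ← hκ, Matrix.mul_kronecker_mul, ← Matrix.conjTranspose_kronecker]
  exact h.orthogonalUnder

theorem TrivialOnLeft.isScaledIsometry (hU : TrivialOnLeft U) (hQ : IsScaledIsometry Q)
    (hQ0 : Q ≠ 0) (h : KeepsOrthogonal U (P ⊗ₖ Q)) : IsScaledIsometry P := by
  obtain ⟨μ, hμ⟩ := hQ
  refine hU _ (Matrix.isHermitian_conjTranspose_mul_self P)
    (OrthogonalUnder.of_smul (ne_zero_of_conjTranspose_mul_self_eq_smul_one hμ hQ0) ?_)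
  rw [← Matrix.kronecker_smul, ← hμ, Matrix.mul_kronecker_mul, ← Matrix.conjTranspose_kronecker]
  exact h.orthogonalUnder

theorem Reachable.exists_kronecker (hX : TrivialOnLeft U) (hY : TrivialOnRight U)
    (hK : Reachable U K) : ∃ (P : Matrix X X ℂ) (Q : Matrix Y Y ℂ),
      IsScaledIsometry P ∧ IsScaledIsometry Q ∧ K = P ⊗ₖ Q := by
  induction hK with
  | start => exact ⟨1, 1, isScaledIsometry_one, isScaledIsometry_one, by simp⟩
  | measure _ L hL hU k ih =>
    obtain ⟨P, Q, hP, hQ, rfl⟩ := ih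
    have hLK := hU k
    rcases hL with ⟨M, -, hM⟩ | ⟨M, -, hM⟩ <;>
      rw [hM, ← Matrix.mul_kronecker_mul, one_mul] at hLK ⊢
    · by_cases hQ0 : Q = 0
      · exact ⟨P, Q, hP, hQ, by simp [hQ0]⟩
      · exact ⟨M k * P, Q, hX.isScaledIsometry hQ hQ0 hLK, hQ, rfl⟩
    · by_cases hP0 : P = 0
      · exact ⟨P, Q, hP, hQ, by simp [hP0]⟩
      · exact ⟨P, M k * Q, hP, hY.isScaledIsometry hP hP0 hLK, rfl⟩

theorem locallyIrreducible_of_trivial (h0 : ∀ ψ ∈ U, ψ ≠ 0) (hX : TrivialOnLeft U)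
    (hY : TrivialOnRight U) : LocallyIrreducible U := by
  rintro K hK ⟨φ, -, hφ⟩ ψ hψ
  obtain ⟨P, Q, hP, hQ, rfl⟩ := hK.exists_kronecker hX hY
  exact (hP.kronecker hQ).actOn_ne_zero hφ (h0 ψ hψ)

theorem OrthogonalUnder.image_congrLeft (e : X × Y ≃ X' × Y') {K' : Matrix (X' × Y') (X' × Y') ℂ}
    (h : OrthogonalUnder U (K'.submatrix e e)) :
    OrthogonalUnder (LinearIsometryEquiv.piLpCongrLeft 2 ℂ ℂ e '' U) K' := by
  rintro _ ⟨ψ, hψ, rfl⟩ _ ⟨φ, hφ, rfl⟩ hne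
  rw [← h hψ hφ (ne_of_apply_ne _ hne), ← LinearIsometryEquiv.inner_map_map
    (LinearIsometryEquiv.piLpCongrLeft 2 ℂ ℂ e) ψ]
  congr 1
  ext p
  simp only [actOn, Matrix.toLpLin_apply, LinearIsometryEquiv.piLpCongrLeft_apply,
    Equiv.piCongrLeft', Equiv.coe_fn_mk, Matrix.mulVec, dotProduct, Matrix.submatrix_apply,
    Equiv.apply_symm_apply]
  exact (Equiv.sum_comp e.symm fun q => K' p (e q) * φ q).symm.trans
    (by simp only [Equiv.apply_symm_apply]) |>.symm

end Bipartite

section Rotation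

variable {a b c n : ℕ}

theorem piLpCongrLeft_groupB_triProd (x : EuclideanSpace ℂ (Fin a)) (y : EuclideanSpace ℂ (Fin b))
    (z : EuclideanSpace ℂ (Fin c)) :
    LinearIsometryEquiv.piLpCongrLeft 2 ℂ ℂ (groupB a b c) (triProd x y z) = triProd y z x := by
  ext p
  exact (mul_assoc (x p.2.2) (y p.1) (z p.2.1)).trans (mul_comm _ _)

theorem Box.image_groupB_states (B : Box) :
    LinearIsometryEquiv.piLpCongrLeft 2 ℂ ℂ (groupB a b c) '' B.states a b c =
      B.rotate.states b c a := by
  have hfreq {i j k : ℕ} : (j, k, i) ∈ B.rotate.freq ∧ (j, k, i) ≠ 0 ↔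
      (i, j, k) ∈ B.freq ∧ (i, j, k) ≠ 0 := by
    simp only [mem_freq, rotate, ne_eq, Prod.mk_eq_zero]
    tauto
  ext ψ
  constructor
  · rintro ⟨_, ⟨⟨i, j, k⟩, hs, rfl⟩, rfl⟩
    exact ⟨(j, k, i), hfreq.2 hs, (piLpCongrLeft_groupB_triProd ..).symm⟩
  · rintro ⟨⟨j, k, i⟩, hs, rfl⟩
    exact ⟨_, ⟨(i, j, k), hfreq.1 hs, rfl⟩, piLpCongrLeft_groupB_triProd ..⟩

theorem image_groupB_setU (a b c n : ℕ) :
    LinearIsometryEquiv.piLpCongrLeft 2 ℂ ℂ (groupB a b c) '' setU a b c n = setU b c a n := by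
  rw [setU_eq, setU_eq, Set.image_insert_eq, Set.image_iUnion, stopper,
    piLpCongrLeft_groupB_triProd,
    ← Tile.rotate_surjective.iUnion_comp fun k : Tile n => (k.box b c a).states b c a]
  simp only [Box.image_groupB_states, Tile.box_rotate, stopper]

theorem image_groupC_setU (a b c n : ℕ) :
    LinearIsometryEquiv.piLpCongrLeft 2 ℂ ℂ (groupC a b c) '' setU a b c n = setU c a b n := by
  rw [← image_groupB_setU b c a, ← image_groupB_setU a b c, Set.image_image]
  rfl

end Rotation

section Nonlocal

variable {a b c n : ℕ} (ha : 2 * n + 3 ≤ a) (hb : 2 * n + 3 ≤ b) (hc : 2 * n + 3 ≤ c)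
include ha hb hc

theorem trivialOnLeft_setU : TrivialOnLeft (setU a b c n) := fun E hH hE => by
  have hsub : ((1 : Matrix (Fin c) (Fin c) ℂ) ⊗ₖ (E ⊗ₖ (1 : Matrix (Fin b) (Fin b) ℂ))).submatrix
      (groupC a b c) (groupC a b c) = E ⊗ₖ (1 : Matrix (Fin b × Fin c) (Fin b × Fin c) ℂ) := by
    rw [← Matrix.one_kronecker_one]
    ext p q
    exact (mul_left_comm _ _ _).trans (congrArg _ (mul_comm _ _))
  have hEright : KeepsOrthogonalRight (setU c a b n) (E ⊗ₖ (1 : Matrix (Fin b) (Fin b) ℂ)) := by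
    rw [← image_groupC_setU]
    exact OrthogonalUnder.image_congrLeft _ (hsub ▸ hE)
  obtain ⟨κ, hκ⟩ := trivialOnRight_setU hc ha hb _
    (by rw [Matrix.IsHermitian, Matrix.conjTranspose_kronecker, hH.eq, Matrix.conjTranspose_one])
    hEright
  refine ⟨κ, Matrix.ext fun i i' => ?_⟩
  have hentry := congrFun₂ hκ (i, ⟨0, by omega⟩) (i', ⟨0, by omega⟩)
  simpa [Matrix.one_apply] using hentry

theorem locallyIrreducible_setU : LocallyIrreducible (setU a b c n) :=
  locallyIrreducible_of_trivial (fun ψ hψ => ((isOPS_setU ha hb hc).1 ψ hψ).1)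
    (trivialOnLeft_setU ha hb hc) (trivialOnRight_setU ha hb hc)

theorem stronglyNonlocal_setU : StronglyNonlocal (setU a b c n) := by
  refine ⟨isOPS_setU ha hb hc, locallyIrreducible_setU ha hb hc, ?_, ?_⟩
  · rw [image_groupB_setU]
    exact locallyIrreducible_setU hb hc ha
  · rw [image_groupC_setU]
    exact locallyIrreducible_setU hc ha hb

end Nonlocal

end

theorem theorem1_general {a b c n : ℕ} (ha : 2 * n + 3 ≤ a) (hb : 2 * n + 3 ≤ b)
    (hc : 2 * n + 3 ≤ c) :
    IsUPB (setU a b c n) ∧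
    ((setU a b c n).ncard : ℤ) = (a : ℤ) * b * c - 8 * (n + 1) ∧
    StronglyNonlocal (setU a b c n) :=
  ⟨isUPB_setU ha hb hc, ncard_setU ha hb hc, stronglyNonlocal_setU ha hb hc⟩

theorem theorem1 (dA dB dC n : ℕ) (hA : 3 ≤ dA) (hAB : dA ≤ dB) (hBC : dB ≤ dC)
    (hn : n ≤ (dA - 3) / 2) :
    IsUPB (setU dA dB dC n) ∧
    ((setU dA dB dC n).ncard : ℤ) = (dA : ℤ) * dB * dC - 8 * (n + 1) ∧
    StronglyNonlocal (setU dA dB dC n) := by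
  exact theorem1_general (by omega) (by omega) (by omega)
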